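/- Let $\mathcal W$ be a subset of a normed space (with its Borel $\sigma$-algebra), and let $\{W_t:t\ge 0\}$ be a time-homogeneous Markov chain on $\mathcal W$ that is irreducible and aperiodic and admits a unique stationary distribution $\nu$. Assume that it is geometrically ergodic with respect to $U(w)=1+\|w\|^{2}$, that is, there is a measurable set $\mathcal W_0\subseteq\mathcal W$ such that (a) there are an integer $N\ge 1$, a constant $b_1>0$ and a probability distribution $\varphi$ on $\mathcal W$ with $\Pr(W_N\in A\mid W_0=w)\ge b_1\varphi(A)$ for all $w\in\mathcal W_0$ and all measurable $A\subseteq\mathcal W$; (b) there are constants $\rho\in[0,1)$ and $b_2>0$ with $\mathbb E[U(W_1)\mid W_0=w]\le\rho U(w)+b_2\mathbb I_{\mathcal W_0}(w)$ for all $w\in\mathcal W$. Let $G:\mathcal W\times\mathbb R^{m}\times\mathbb R^{n}\to\mathbb R^{m}$ and $H:\mathcal W\times\mathbb R^{n}\to\mathbb R^{n}$ be measurable, and let $\bar G(\lambda,\xi)=\mathbb E_\nu[G(W,\lambda,\xi)]$ and $\bar H(\xi)=\mathbb E_\nu[H(W,\xi)]$. Assume the following. (i) The equation $\bar H(\xi)=0$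 has a unique solution $\xi^*$, and the equation $\bar G(\lambda,\xi^*)=0$ has a unique solution $\lambda^*$. (ii) $B>\max(\|\lambda^*\|,\|\xi^*\|)$, and there are a constant $L>0$ and a positive function $h$ on $\mathcal W$ with $h(w)\le L(1+\|w\|)$ such that, for all $w\in\mathcal W$ and all $\lambda,\tilde\lambda\in\mathbb R^m$, $\xi,\tilde\xi\in\mathbb R^n$ of norm at most $B$, $$\|G(w,\lambda,\xi)-G(w,\tilde\lambda,\tilde\xi)\|\le h(w)\bigl(\|\lambda-\tilde\lambda\|+\|\xi-\tilde\xi\|\bigr),\qquad \|H(w,\xi)-H(w,\tilde\xi)\|\le h(w)\|\xi-\tilde\xi\|,$$ $$\|G(w,\lambda,\xi)\|\le L(1+\|w\|),\qquad \|H(w,\xi)\|\le L(1+\|w\|).$$ (iii) There are constants $\zeta,\psi>0$ such that for all $\lambda\in\mathbb R^m$ and $\xi\in\mathbb R^n$, $$(\lambda-\lambda^*)^{\top}\bigl(\bar G(\lambda,\xi^*)-\bar G(\lambda^*,\xi^*)\bigr)\le-\zeta\|\lambda-\lambda^*\|^2,\qquad (\xi-\xi^*)^{\top}\bigl(\bar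 H(\xi)-\bar H(\xi^*)\bigr)\le-\psi\|\xi-\xi^*\|^2 .$$ Let $0<\kappa\le\delta\le1$, $\alpha_0,\beta_0>0$, and $\alpha_t=\alpha_0t^{-\kappa}$, $\beta_t=\beta_0t^{-\delta}$ for $t\ge1$; assume $\zeta\alpha_0>1$ if $\kappa=1$, and $\psi\beta_0>1$ if $\delta=1$. Let $\Pi_B$ denote the projection onto the closed ball of radius $B$ centred at $0$, and for (deterministic) initial points $\lambda_0\in\mathbb R^m$, $\xi_0\in\mathbb R^n$ let $$\lambda_{t+1}=\Pi_B\bigl(\lambda_t+\alpha_tG(W_t,\lambda_t,\xi_t)\bigr),\qquad \xi_{t+1}=\Pi_B\bigl(\xi_t+\beta_tH(W_t,\xi_t)\bigr),\qquad t\ge0.$$ Then for every $w\in\mathcal W$ there are constants $k_1\ge0$ and $k_2>0$, depending on $w$ but not on $t$ or on the initial points, such that for all $\lambda_0,\xi_0$ and all sufficiently large $t$, $$\mathbb E\bigl[\|\lambda_t-\lambda^*\|^2\mid W_0=w\bigr]\le t^{-\kappa}(k_1\ln t+k_2),\qquad \mathbb E\bigl[\|\xi_t-\xi^*\|^2\mid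 W_0=w\bigr]\le t^{-\delta}(k_1\ln t+k_2).$$ Moreover, $k_1=0$ if the noise is i.i.d., i.e. if, given $W_0=w$, the variables $W_1,W_2,\dots$ are independent with common distribution $\nu$. -/

import Mathlib

open MeasureTheory ProbabilityTheory Filter

/-- The projection `Π_B` of a Euclidean space onto its closed ball of radius `B` centred at `0`
(for `0 < B`): points of the ball are fixed, all others are scaled back radially. -/
noncomputable def ballProj {d : ℕ} (B : ℝ) (x : EuclideanSpace ℝ (Fin d)) :
    EuclideanSpace ℝ (Fin d) :=
  if ‖x‖ ≤ B then x else (B / ‖x‖) • x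

/-- The projected two-timescale iterates `(lam_t, xi_t)` driven by the noise sequence
`w 0, w 1, w 2, …`, started at `(lam₀, xi₀)`:
`lam_{t+1} = Π_B (lam_t + α_t G(w_t, lam_t, xi_t))` and
`xi_{t+1} = Π_B (xi_t + β_t H(w_t, xi_t))`. -/
noncomputable def saIterates {S : Type*} {m n : ℕ} (B : ℝ) (α β : ℕ → ℝ)
    (G : S → EuclideanSpace ℝ (Fin m) → EuclideanSpace ℝ (Fin n) → EuclideanSpace ℝ (Fin m))
    (H : S → EuclideanSpace ℝ (Fin n) → EuclideanSpace ℝ (Fin n))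
    (lam₀ : EuclideanSpace ℝ (Fin m)) (xi₀ : EuclideanSpace ℝ (Fin n)) (w : ℕ → S) :
    ℕ → EuclideanSpace ℝ (Fin m) × EuclideanSpace ℝ (Fin n)
  | 0 => (lam₀, xi₀)
  | t + 1 =>
    let z := saIterates B α β G H lam₀ xi₀ w t
    (ballProj B (z.1 + α t • G (w t) z.1 z.2), ballProj B (z.2 + β t • H (w t) z.2))

/-- The law, on the space of trajectories, of the time-homogeneous Markov chain `W_0, W_1, …` with
transition kernel `P` started at `W_0 = w` (Ionescu-Tulcea). Integration against this measure is
the conditional expectation `E[ · | W_0 = w]`. -/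
noncomputable def chainLaw {S : Type*} [MeasurableSpace S] (P : Kernel S S) [IsMarkovKernel P]
    (w : S) : Measure (ℕ → S) :=
  Kernel.traj (X := fun _ : ℕ => S)
    (fun t => P.comap (fun x : (i : Finset.Iic t) → S => x ⟨t, Finset.mem_Iic.2 le_rfl⟩)
      (measurable_pi_apply _)) 0 (fun _ => w)

/-- A chain with stationary distribution `ν` is aperiodic if it has no cycle of `d ≥ 2` disjoint
measurable classes `D_0 → D_1 → … → D_{d-1} → D_0` of positive `ν`-measure, each of which is mapped
to the next one with probability one. -/
def IsAperiodicChain {S : Type*} [MeasurableSpace S] (P : Kernel S S) (ν : Measure S) : Prop :=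
  ¬ ∃ (d : ℕ) (D : ZMod d → Set S), 2 ≤ d ∧ (∀ i, MeasurableSet (D i)) ∧
    (∀ i j, i ≠ j → Disjoint (D i) (D j)) ∧
    (∀ i, ∀ w ∈ D i, P w (D (i + 1)) = 1) ∧ (∀ i, 0 < ν (D i))

/-- The Markov chain with transition kernel `P` on the state space `𝒲 ⊆ E` is irreducible and
aperiodic, has `ν` as its unique stationary distribution, and is geometrically ergodic with respect
to `U(w) = 1 + ‖w‖ ^ dU` in the sense of a minorization condition on a set `𝒲₀` together with a
geometric drift condition towards `𝒲₀`. -/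
structure IsGeometricallyErgodicChain {E : Type*} [NormedAddCommGroup E] [MeasurableSpace E]
    {𝒲 : Set E} (P : Kernel 𝒲 𝒲) (ν : Measure 𝒲) (dU : ℝ) : Prop where
  irreducible : ∃ φ : Measure 𝒲, SigmaFinite φ ∧ φ ≠ 0 ∧ Kernel.IsIrreducible φ P
  aperiodic : IsAperiodicChain P ν
  isProbabilityMeasure : IsProbabilityMeasure ν
  invariant : Kernel.Invariant P ν
  unique : ∀ ν' : Measure 𝒲, IsProbabilityMeasure ν' → Kernel.Invariant P ν' → ν' = ν
  minorization_drift : ∃ 𝒲₀ : Set 𝒲, MeasurableSet 𝒲₀ ∧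
    (∃ N : ℕ, 1 ≤ N ∧ ∃ b₁ : ℝ, 0 < b₁ ∧ ∃ ψ : Measure 𝒲, IsProbabilityMeasure ψ ∧
      ∀ w ∈ 𝒲₀, ∀ A : Set 𝒲, MeasurableSet A → ENNReal.ofReal b₁ * ψ A ≤ (P ^ N) w A) ∧
    (∃ ρ : ℝ, 0 ≤ ρ ∧ ρ < 1 ∧ ∃ b₂ : ℝ, 0 < b₂ ∧
      ∀ w : 𝒲, ∫⁻ w', ENNReal.ofReal (1 + ‖(w' : E)‖ ^ dU) ∂(P w) ≤
        ENNReal.ofReal (ρ * (1 + ‖(w : E)‖ ^ dU) + 𝒲₀.indicator (fun _ => b₂) w))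

/-- The conditions on the update functions `G`, `H`, where `Ḡ(lam, xi) = E_ν[G(W, lam, xi)]` and
`H̄(xi) = E_ν[H(W, xi)]`: `xiStar` and `lamStar` are the unique roots of `H̄` and `Ḡ(·, xiStar)`,
they lie in the open ball of radius `B`, `G` and `H` are Lipschitz and bounded on the closed ball of
radius `B` with coefficients of linear growth in `‖w‖`, and `Ḡ(·, xiStar)` and `H̄` are strongly
monotone at the roots, with constants `ζ` and `ψ`. -/
structure SAConditions {E : Type*} [NormedAddCommGroup E] [MeasurableSpace E]
    {𝒲 : Set E} {m n : ℕ} (ν : Measure 𝒲)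
    (G : 𝒲 → EuclideanSpace ℝ (Fin m) → EuclideanSpace ℝ (Fin n) → EuclideanSpace ℝ (Fin m))
    (H : 𝒲 → EuclideanSpace ℝ (Fin n) → EuclideanSpace ℝ (Fin n))
    (lamStar : EuclideanSpace ℝ (Fin m)) (xiStar : EuclideanSpace ℝ (Fin n))
    (B ζ ψ : ℝ) : Prop where
  root_H : ∀ xi, ∫ w, H w xi ∂ν = 0 ↔ xi = xiStar
  root_G : ∀ lam, ∫ w, G w lam xiStar ∂ν = 0 ↔ lam = lamStar
  lt_radius : max ‖lamStar‖ ‖xiStar‖ < B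
  lipschitz_growth : ∃ (h : 𝒲 → ℝ) (L : ℝ), 0 < L ∧
    (∀ w, 0 < h w ∧ h w ≤ L * (1 + ‖(w : E)‖)) ∧
    (∀ w lam lam' xi xi', ‖lam‖ ≤ B → ‖lam'‖ ≤ B → ‖xi‖ ≤ B → ‖xi'‖ ≤ B →
      ‖G w lam xi - G w lam' xi'‖ ≤ h w * (‖lam - lam'‖ + ‖xi - xi'‖)) ∧
    (∀ w xi xi', ‖xi‖ ≤ B → ‖xi'‖ ≤ B → ‖H w xi - H w xi'‖ ≤ h w * ‖xi - xi'‖) ∧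
    (∀ w lam xi, ‖lam‖ ≤ B → ‖xi‖ ≤ B → ‖G w lam xi‖ ≤ L * (1 + ‖(w : E)‖)) ∧
    (∀ w xi, ‖xi‖ ≤ B → ‖H w xi‖ ≤ L * (1 + ‖(w : E)‖))
  zeta_pos : 0 < ζ
  psi_pos : 0 < ψ
  monotone_G : ∀ lam, inner ℝ (lam - lamStar)
    ((∫ w, G w lam xiStar ∂ν) - ∫ w, G w lamStar xiStar ∂ν) ≤ -ζ * ‖lam - lamStar‖ ^ 2
  monotone_H : ∀ xi, inner ℝ (xi - xiStar)
    ((∫ w, H w xi ∂ν) - ∫ w, H w xiStar ∂ν) ≤ -ψ * ‖xi - xiStar‖ ^ 2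

/-- The noise sequence is i.i.d. with distribution `ν`, given its starting value `w`: under the law
of the chain started at `W_0 = w`, the variables `W_0, W_1, W_2, …` are independent and each of
`W_1, W_2, …` has distribution `ν`. -/
def IsIIDGivenStart {S : Type*} [MeasurableSpace S] (P : Kernel S S) [IsMarkovKernel P]
    (ν : Measure S) (w : S) : Prop :=
  iIndepFun (fun (t : ℕ) (W : ℕ → S) => W t) (chainLaw P w) ∧
    ∀ t : ℕ, 1 ≤ t → (chainLaw P w).map (fun W => W t) = ν

/-! The squared errors obey a linear recursion. Nonexpansiveness of the projection and strong
monotonicity give, up to terms of order `α_t ^ 2`, a contraction factor `1 - ζ α_t`, a multiple of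
`α_t ‖ξ_t - ξ*‖ ^ 2`, and a noise term `2 α_t f_θ(W_t)`. Here `θ = (λ_t, ξ_t)`, and `f_θ` is the
centred field paired with the error, so that `f_θ` has `ν`-mean zero (`norm_sq_step_le`).

The noise is removed by the Poisson equation `u_θ - P u_θ = f_θ`. By the Markov property, the mean
of `f_θ(W_t)` at `θ = θ_t` is `D_t - D_{t+1}`, with `D_t` the mean of `u_{θ_t}(W_t)`, plus the
effect of replacing `θ_t` by `θ_{t+1}` at `W_{t+1}`. Since `u_θ` is Lipschitz in `θ`, that effect is
`O(α_t)` (`PoissonSetting.integral_noise_le`). Adding `2 α_t D_t` to the mean square error absorbs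
the telescoping part, and induction gives the rate `t ^ (-κ)` (`exists_recursion_bound`). No
logarithm appears, so `k₁ = 0` works for every chain covered.

The Poisson equation is solved in a weighted supremum norm
(`DriftMinorization.exists_weighted_poisson`). The weight is `V + K`, where `V` is the square root
of `1 + ‖w‖ ^ 2`: it inherits a drift condition, and products of two values of `V` remain
integrable. Passing to the resolvent `R = ∑ ε ^ k P ^ k` turns the `N`-step minorization on `C` into
a one-step one. The operator that moves by `P` off `C` and by `(1 - ε) R` on `C`, with the
minorizing part subtracted, is then positive and, for a suitable `K`, a strict contraction. Its
Neumann series yields a candidate solution, and integration against `ν` shows that the defect of the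
candidate vanishes (`exists_poisson_of_norm_taboo_lt_one`).

Both timescales come from one theorem, `PoissonSetting.exists_rate_bound`. For `ξ` the auxiliary
process is trivial; for `λ` it is `ξ`, which moves no faster in order and converges at least as fast
because `κ ≤ δ`. -/

/-! ### The Banach space of bounded measurable functions and positive operators on it -/

/-- The bounded measurable real functions as a subspace of the space of bounded functions. -/
def boundedMeasurableSubmodule (S : Type*) [MeasurableSpace S] :
    Submodule ℝ (lp (fun _ : S => ℝ) ⊤) where
  carrier := {f | Measurable (f : S → ℝ)}
  add_mem' := by
    intro f g hf hg
    simp only [Set.mem_ofPred_eq, lp.coeFn_add] at *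
    exact hf.add hg
  zero_mem' := by
    simp only [Set.mem_ofPred_eq, lp.coeFn_zero]
    exact measurable_zero
  smul_mem' := by
    intro c f hf
    simp only [Set.mem_ofPred_eq, lp.coeFn_smul] at *
    exact hf.const_smul c

/-- The Banach space of bounded measurable real functions with the supremum norm. -/
def BoundedMeasurable (S : Type*) [MeasurableSpace S] : Type _ := boundedMeasurableSubmodule S

namespace BoundedMeasurable

variable {S : Type*} [MeasurableSpace S]

noncomputable instance : NormedAddCommGroup (BoundedMeasurable S) :=
  inferInstanceAs (NormedAddCommGroup (boundedMeasurableSubmodule S))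

noncomputable instance : NormedSpace ℝ (BoundedMeasurable S) :=
  inferInstanceAs (NormedSpace ℝ (boundedMeasurableSubmodule S))

instance : FunLike (BoundedMeasurable S) S ℝ where
  coe x := x.1
  coe_injective _ _ h := Subtype.ext (lp.ext h)

lemma measurable (x : BoundedMeasurable S) : Measurable (x : S → ℝ) := x.2

lemma abs_apply_le (x : BoundedMeasurable S) (w : S) : |x w| ≤ ‖x‖ :=
  lp.norm_apply_le_norm (by simp) x.1 w

lemma norm_le {x : BoundedMeasurable S} {c : ℝ} (hc : 0 ≤ c) (h : ∀ w, |x w| ≤ c) : ‖x‖ ≤ c :=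
  lp.norm_le_of_forall_le hc h

@[simp] lemma add_apply (x y : BoundedMeasurable S) (w : S) : (x + y) w = x w + y w := rfl

@[simp] lemma sub_apply (x y : BoundedMeasurable S) (w : S) : (x - y) w = x w - y w := rfl

@[simp] lemma neg_apply (x : BoundedMeasurable S) (w : S) : (-x) w = - x w := rfl

@[simp] lemma smul_apply (c : ℝ) (x : BoundedMeasurable S) (w : S) : (c • x) w = c * x w := rfl

lemma ext {x y : BoundedMeasurable S} (h : ∀ w, x w = y w) : x = y :=
  DFunLike.ext _ _ h

/-- A bounded measurable function as an element of the Banach space. -/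
def mk (f : S → ℝ) (hf : Measurable f) (c : ℝ) (hc : ∀ w, |f w| ≤ c) : BoundedMeasurable S :=
  ⟨⟨f, memℓp_infty ⟨c, by rintro _ ⟨w, rfl⟩; exact hc w⟩⟩, hf⟩

@[simp] lemma mk_apply (f : S → ℝ) (hf : Measurable f) (c : ℝ) (hc : ∀ w, |f w| ≤ c) (w : S) :
    mk f hf c hc w = f w := rfl

/-- Pointwise limits of measurable functions are measurable, so the subspace is closed. Completeness
is what makes the Neumann series converge. -/
instance : CompleteSpace (BoundedMeasurable S) := by
  have hcl : IsClosed ((boundedMeasurableSubmodule S : Set (lp (fun _ : S => ℝ) ⊤))) := by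
    refine IsSeqClosed.isClosed fun f g hf hg => ?_
    refine measurable_of_tendsto_metrizable (f := fun k => (f k : S → ℝ)) hf ?_
    rw [tendsto_pi_nhds]
    intro w
    rw [tendsto_iff_norm_sub_tendsto_zero] at hg ⊢
    refine squeeze_zero (fun _ => norm_nonneg _) (fun k => ?_) hg
    exact lp.norm_apply_le_norm (by simp) (f k - g) w
  exact hcl.completeSpace_coe

/-- An operator is positive if it maps nonnegative functions to nonnegative functions. -/
def IsPos (T : BoundedMeasurable S →L[ℝ] BoundedMeasurable S) : Prop :=
  ∀ x : BoundedMeasurable S, (∀ w, 0 ≤ x w) → ∀ w, 0 ≤ T x w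

lemma IsPos.mono {T : BoundedMeasurable S →L[ℝ] BoundedMeasurable S} (hT : IsPos T)
    {x y : BoundedMeasurable S} (h : ∀ w, x w ≤ y w) (w : S) : T x w ≤ T y w := by
  have := hT (y - x) (fun w => by simpa using h w) w
  rw [map_sub, sub_apply] at this
  linarith

/-- The constant function `1`. -/
def unit : BoundedMeasurable S := mk (fun _ => 1) measurable_const 1 (by simp)

@[simp] lemma unit_apply (w : S) : (unit : BoundedMeasurable S) w = 1 := rfl

/-- Positivity gives `|T x| ≤ ‖x‖ T 1`, so a contraction estimate need only be checked on the
constant `1`, which represents the weight itself in the weighted picture. -/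
lemma IsPos.norm_le {T : BoundedMeasurable S →L[ℝ] BoundedMeasurable S} (hT : IsPos T)
    {r : ℝ} (hr : 0 ≤ r) (h : ∀ w, T unit w ≤ r) : ‖T‖ ≤ r := by
  refine T.opNorm_le_bound hr fun x => BoundedMeasurable.norm_le (by positivity) fun w => ?_
  have h1 := hT.mono (x := x) (y := ‖x‖ • unit)
    (fun w => by simpa using (abs_le.1 (x.abs_apply_le w)).2) w
  have h2 := hT.mono (x := -x) (y := ‖x‖ • unit)
    (fun w => by simpa using neg_le.1 (abs_le.1 (x.abs_apply_le w)).1) w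
  have h3 : ‖x‖ * T unit w ≤ r * ‖x‖ := by
    rw [mul_comm]; exact mul_le_mul_of_nonneg_right (h w) (norm_nonneg _)
  rw [map_smul, smul_apply] at h1 h2
  rw [map_neg, neg_apply] at h2
  rw [abs_le]
  constructor <;> linarith

/-- A fixed point of `x + T ·`, with `T` a positive contraction and `0 ≤ x`, is nonnegative. -/
lemma IsPos.nonneg_of_eq_add {T : BoundedMeasurable S →L[ℝ] BoundedMeasurable S} (hT : IsPos T)
    (hn : ‖T‖ < 1) {x y : BoundedMeasurable S} (hx : ∀ w, 0 ≤ x w) (hy : y = x + T y) (w : S) :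
    0 ≤ y w := by
  -- The negative part `z` of `y` satisfies `0 ≤ z ≤ T z`, hence `‖z‖ ≤ ‖T‖ ‖z‖`, which forces `z =
  -- 0`.
  let z : BoundedMeasurable S := mk (fun w => max (-y w) 0) (y.measurable.neg.max measurable_const)
    ‖y‖ (fun w => by
      have := y.abs_apply_le w
      rw [abs_of_nonneg (le_max_right _ _)]
      exact max_le ((neg_le_abs _).trans this) (norm_nonneg _))
  have hz0 : ∀ w, 0 ≤ z w := fun w => le_max_right _ _
  have hzT : ∀ w, z w ≤ T z w := by
    intro w
    refine max_le ?_ (hT z hz0 w)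
    have h1 := hT.mono (x := -y) (y := z) (fun w => le_max_left _ _) w
    have h2 : y w = x w + T y w := by rw [← add_apply, ← hy]
    rw [map_neg, neg_apply] at h1
    have := hx w
    linarith
  have hzn : ‖z‖ ≤ ‖T‖ * ‖z‖ := by
    refine BoundedMeasurable.norm_le (by positivity) fun w => ?_
    rw [abs_of_nonneg (hz0 w)]
    exact (hzT w).trans (((le_abs_self _).trans ((T z).abs_apply_le w)).trans (T.le_opNorm z))
  have hz : ‖z‖ = 0 := by
    by_contra h
    have : 0 < ‖z‖ := lt_of_le_of_ne (norm_nonneg _) (Ne.symm h)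
    nlinarith
  have h3 := z.abs_apply_le w
  rw [hz] at h3
  have h4 : z w = 0 := abs_eq_zero.1 (le_antisymm h3 (abs_nonneg _))
  have h5 : -y w ≤ z w := le_max_left _ _
  linarith

lemma eq_zero_of_eq_apply {T : BoundedMeasurable S →L[ℝ] BoundedMeasurable S}
    (hn : ‖T‖ < 1) {y : BoundedMeasurable S} (hy : y = T y) : y = 0 := by
  by_contra h
  have h0 : 0 < ‖y‖ := norm_pos_iff.2 h
  have h1 := T.le_opNorm y
  rw [← hy] at h1
  nlinarith

/-- The Neumann series inverts `1 - T` for a contraction `T`. -/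
lemma exists_resolvent (T : BoundedMeasurable S →L[ℝ] BoundedMeasurable S) (hn : ‖T‖ < 1) :
    ∃ R : BoundedMeasurable S →L[ℝ] BoundedMeasurable S,
      (∀ x, R x = x + T (R x)) ∧ ∀ x, R (x - T x) = x := by
  let U := Units.oneSub T hn
  have h1 : (1 - T) * (↑U⁻¹ : BoundedMeasurable S →L[ℝ] BoundedMeasurable S) = 1 := U.mul_inv
  have h2 : (↑U⁻¹ : BoundedMeasurable S →L[ℝ] BoundedMeasurable S) * (1 - T) = 1 := U.inv_mul
  refine ⟨↑U⁻¹, fun x => ?_, fun x => ?_⟩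
  · have := DFunLike.congr_fun h1 x
    exact sub_eq_iff_eq_add.1 this
  · exact DFunLike.congr_fun h2 x

/-- Multiplication by the indicator function of a measurable set. -/
noncomputable def restrict (C : Set S) (hC : MeasurableSet C) :
    BoundedMeasurable S →L[ℝ] BoundedMeasurable S :=
  LinearMap.mkContinuous
    { toFun := fun x => mk (C.indicator x) (x.measurable.indicator hC) ‖x‖ (fun w => by
        by_cases hw : w ∈ C <;> simp [hw, x.abs_apply_le])
      map_add' := fun x y => ext fun w => by by_cases hw : w ∈ C <;> simp [hw]
      map_smul' := fun c x => ext fun w => by by_cases hw : w ∈ C <;> simp [hw] }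
    1 (fun x => norm_le (by positivity) fun w => by
        by_cases hw : w ∈ C <;> simp [hw, x.abs_apply_le])

@[simp] lemma restrict_apply (C : Set S) (hC : MeasurableSet C) (x : BoundedMeasurable S) (w : S) :
    restrict C hC x w = C.indicator x w := rfl

/-! ### Weighted kernel operators -/

/-- The function `Φ x` represented by the element `x` of the weighted space. -/
def weighted (Φ : S → ℝ) (x : BoundedMeasurable S) : S → ℝ := fun w => Φ w * x w

variable {Φ : S → ℝ}

lemma measurable_weighted (hΦ : Measurable Φ) (x : BoundedMeasurable S) :
    Measurable (weighted Φ x) := hΦ.mul x.measurable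

lemma abs_weighted_le (hΦ : ∀ w, 0 < Φ w) (x : BoundedMeasurable S) (w : S) :
    |weighted Φ x w| ≤ ‖x‖ * Φ w := by
  rw [weighted, abs_mul, abs_of_pos (hΦ w), mul_comm]
  exact mul_le_mul_of_nonneg_right (x.abs_apply_le w) (hΦ w).le

lemma integrable_weighted (hΦm : Measurable Φ) (hΦ : ∀ w, 0 < Φ w) {μ : Measure S}
    (hi : Integrable Φ μ) (x : BoundedMeasurable S) : Integrable (weighted Φ x) μ :=
  (hi.const_mul ‖x‖).mono' (measurable_weighted hΦm x).aestronglyMeasurable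
    (ae_of_all _ fun w => abs_weighted_le hΦ x w)

/-- A function with `|f| ≤ c Φ` as an element of the weighted space. -/
noncomputable def ofWeighted (hΦm : Measurable Φ) (hΦ : ∀ w, 0 < Φ w) (f : S → ℝ)
    (hf : Measurable f) (c : ℝ) (hc : ∀ w, |f w| ≤ c * Φ w) : BoundedMeasurable S :=
  mk (fun w => f w / Φ w) (hf.div hΦm) c (fun w => by
    rw [abs_div, abs_of_pos (hΦ w), div_le_iff₀ (hΦ w)]; exact hc w)

lemma weighted_ofWeighted (hΦm : Measurable Φ) (hΦ : ∀ w, 0 < Φ w) (f : S → ℝ)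
    (hf : Measurable f) (c : ℝ) (hc : ∀ w, |f w| ≤ c * Φ w) :
    weighted Φ (ofWeighted hΦm hΦ f hf c hc) = f := by
  funext w
  simp only [weighted, ofWeighted, mk_apply]
  rw [mul_div_cancel₀ _ (hΦ w).ne']

lemma weighted_injective (hΦ : ∀ w, 0 < Φ w) {x y : BoundedMeasurable S}
    (h : ∀ w, weighted Φ x w = weighted Φ y w) : x = y :=
  ext fun w => mul_left_cancel₀ (hΦ w).ne' (h w)

lemma weighted_add (x y : BoundedMeasurable S) (w : S) :
    weighted Φ (x + y) w = weighted Φ x w + weighted Φ y w := mul_add _ _ _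

lemma weighted_sub (x y : BoundedMeasurable S) (w : S) :
    weighted Φ (x - y) w = weighted Φ x w - weighted Φ y w := mul_sub _ _ _

lemma weighted_smul (c : ℝ) (x : BoundedMeasurable S) (w : S) :
    weighted Φ (c • x) w = c * weighted Φ x w := by
  simp only [weighted, smul_apply]; ring

lemma weighted_nonneg_iff (hΦ : ∀ w, 0 < Φ w) {x : BoundedMeasurable S} {w : S} :
    0 ≤ weighted Φ x w ↔ 0 ≤ x w := mul_nonneg_iff_of_pos_left (hΦ w)

lemma abs_integral_weighted_le (hΦ : ∀ w, 0 < Φ w) {μ : Measure S}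
    (hi : Integrable Φ μ) (x : BoundedMeasurable S) :
    |∫ w, weighted Φ x w ∂μ| ≤ ‖x‖ * ∫ w, Φ w ∂μ := by
  rw [← integral_const_mul]
  exact norm_integral_le_of_norm_le (f := weighted Φ x) (hi.const_mul ‖x‖)
    (ae_of_all _ fun w => abs_weighted_le hΦ x w)

/-- Integration of the represented function against a measure integrating the weight. -/
noncomputable def integralCLM (hΦm : Measurable Φ) (hΦ : ∀ w, 0 < Φ w) (μ : Measure S)
    (hi : Integrable Φ μ) : BoundedMeasurable S →L[ℝ] ℝ :=
  LinearMap.mkContinuous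
    { toFun := fun x => ∫ w, weighted Φ x w ∂μ
      map_add' := fun x y => by
        simp only [weighted_add]
        exact integral_add (integrable_weighted hΦm hΦ hi x) (integrable_weighted hΦm hΦ hi y)
      map_smul' := fun c x => by
        simp only [weighted_smul, integral_const_mul, RingHom.id_apply, smul_eq_mul] }
    (∫ w, Φ w ∂μ) (fun x => (abs_integral_weighted_le hΦ hi x).trans_eq (mul_comm _ _))

@[simp] lemma integralCLM_apply (hΦm : Measurable Φ) (hΦ : ∀ w, 0 < Φ w) (μ : Measure S)
    (hi : Integrable Φ μ) (x : BoundedMeasurable S) :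
    integralCLM hΦm hΦ μ hi x = ∫ w, weighted Φ x w ∂μ := rfl

/-- The operator on the weighted space induced by a kernel. -/
noncomputable def kernelCLM (hΦm : Measurable Φ) (hΦ : ∀ w, 0 < Φ w) (P : Kernel S S)
    [IsMarkovKernel P] (hi : ∀ w, Integrable Φ (P w)) (c : ℝ) (hc : 0 ≤ c)
    (hP : ∀ w, ∫ w', Φ w' ∂(P w) ≤ c * Φ w) : BoundedMeasurable S →L[ℝ] BoundedMeasurable S :=
  LinearMap.mkContinuous
    { toFun := fun x => ofWeighted hΦm hΦ (fun w => ∫ w', weighted Φ x w' ∂(P w))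
        ((measurable_weighted hΦm x).stronglyMeasurable.integral_kernel (κ := P)).measurable (‖x‖ * c)
        (fun w => (abs_integral_weighted_le hΦ (hi w) x).trans (by
          rw [mul_assoc]; exact mul_le_mul_of_nonneg_left (hP w) (norm_nonneg _)))
      map_add' := fun x y => weighted_injective hΦ fun w => by
        rw [weighted_add]
        simp only [weighted_ofWeighted, weighted_add]
        exact integral_add (integrable_weighted hΦm hΦ (hi w) x)
          (integrable_weighted hΦm hΦ (hi w) y)
      map_smul' := fun a x => weighted_injective hΦ fun w => by
        rw [RingHom.id_apply, weighted_smul]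
        simp only [weighted_ofWeighted, weighted_smul, integral_const_mul] }
    c (fun x => norm_le (by positivity) fun w => by
      change |(∫ w', weighted Φ x w' ∂(P w)) / Φ w| ≤ _
      rw [abs_div, abs_of_pos (hΦ w), div_le_iff₀ (hΦ w)]
      refine (abs_integral_weighted_le hΦ (hi w) x).trans ?_
      nlinarith [mul_le_mul_of_nonneg_left (hP w) (norm_nonneg x)])

lemma weighted_kernelCLM (hΦm : Measurable Φ) (hΦ : ∀ w, 0 < Φ w) (P : Kernel S S)
    [IsMarkovKernel P] (hi : ∀ w, Integrable Φ (P w)) (c : ℝ) (hc : 0 ≤ c)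
    (hP : ∀ w, ∫ w', Φ w' ∂(P w) ≤ c * Φ w) (x : BoundedMeasurable S) (w : S) :
    weighted Φ (kernelCLM hΦm hΦ P hi c hc hP x) w = ∫ w', weighted Φ x w' ∂(P w) := by
  change Φ w * ((∫ w', weighted Φ x w' ∂(P w)) / Φ w) = _
  rw [mul_div_cancel₀ _ (hΦ w).ne']

lemma isPos_kernelCLM (hΦm : Measurable Φ) (hΦ : ∀ w, 0 < Φ w) (P : Kernel S S)
    [IsMarkovKernel P] (hi : ∀ w, Integrable Φ (P w)) (c : ℝ) (hc : 0 ≤ c)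
    (hP : ∀ w, ∫ w', Φ w' ∂(P w) ≤ c * Φ w) : IsPos (kernelCLM hΦm hΦ P hi c hc hP) := by
  intro x hx w
  rw [← weighted_nonneg_iff hΦ, weighted_kernelCLM]
  exact integral_nonneg fun w' => (weighted_nonneg_iff hΦ).2 (hx w')

lemma norm_kernelCLM_le (hΦm : Measurable Φ) (hΦ : ∀ w, 0 < Φ w) (P : Kernel S S)
    [IsMarkovKernel P] (hi : ∀ w, Integrable Φ (P w)) (c : ℝ) (hc : 0 ≤ c)
    (hP : ∀ w, ∫ w', Φ w' ∂(P w) ≤ c * Φ w) : ‖kernelCLM hΦm hΦ P hi c hc hP‖ ≤ c :=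
  LinearMap.mkContinuous_norm_le _ hc _

end BoundedMeasurable

namespace BoundedMeasurable

variable {S : Type*} [MeasurableSpace S]

/-! ### The Poisson equation -/

/-- The sub-Markovian operator which moves by `P` off `C` and by the resolvent on `C`, minus the
minorizing part `c 1_C ⊗ Ψ`. -/
noncomputable def taboo (P R : BoundedMeasurable S →L[ℝ] BoundedMeasurable S) (ε c : ℝ)
    (C : Set S) (hC : MeasurableSet C) (Ψ : BoundedMeasurable S →L[ℝ] ℝ)
    (one : BoundedMeasurable S) : BoundedMeasurable S →L[ℝ] BoundedMeasurable S :=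
  (restrict Cᶜ hC.compl).comp P + (restrict C hC).comp ((1 - ε) • R) -
    Ψ.smulRight (c • restrict C hC one)

lemma taboo_apply_mem {P R : BoundedMeasurable S →L[ℝ] BoundedMeasurable S} {ε c : ℝ}
    {C : Set S} {hC : MeasurableSet C} {Ψ : BoundedMeasurable S →L[ℝ] ℝ}
    {one : BoundedMeasurable S} (x : BoundedMeasurable S) {w : S} (hw : w ∈ C) :
    taboo P R ε c C hC Ψ one x w = (1 - ε) * R x w - Ψ x * (c * one w) := by
  simp [taboo, hw]

lemma taboo_apply_notMem {P R : BoundedMeasurable S →L[ℝ] BoundedMeasurable S} {ε c : ℝ}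
    {C : Set S} {hC : MeasurableSet C} {Ψ : BoundedMeasurable S →L[ℝ] ℝ}
    {one : BoundedMeasurable S} (x : BoundedMeasurable S) {w : S} (hw : w ∉ C) :
    taboo P R ε c C hC Ψ one x w = P x w := by
  simp [taboo, hw]

/-- The Poisson equation `u - P u = g` is solvable by a bounded operator when the taboo operator
is a contraction. -/
lemma exists_poisson_of_norm_taboo_lt_one
    {P R : BoundedMeasurable S →L[ℝ] BoundedMeasurable S} (hP : IsPos P)
    {ε c : ℝ} (hε0 : 0 < ε) (hε1 : ε < 1) (hεP : ‖ε • P‖ < 1)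
    (hR : ∀ x, R x = x + ε • P (R x)) (hR' : ∀ x, R (x - ε • P x) = x)
    {C : Set S} (hC : MeasurableSet C) {Ψ ν : BoundedMeasurable S →L[ℝ] ℝ}
    {one : BoundedMeasurable S} (hone : ∀ w, 0 ≤ one w)
    (hM : ‖taboo P R ε c C hC Ψ one‖ < 1)
    (hνP : ∀ x, ν (P x) = ν x) (hν0 : ∀ x : BoundedMeasurable S, (∀ w, 0 ≤ x w) → 0 ≤ ν x)
    (hνC : 0 < ν (restrict C hC one)) :
    ∃ D : BoundedMeasurable S →L[ℝ] BoundedMeasurable S, ∀ g, ν g = 0 → D g = g + P (D g) := by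
  obtain ⟨Q, hQ, -⟩ := exists_resolvent _ hM
  -- The source term is `g` off `C` and `ε R g` on `C`, matching the two modes of motion of the
  -- taboo operator; `Q` is the resolvent of that operator.
  refine ⟨Q.comp (restrict Cᶜ hC.compl + ε • (restrict C hC).comp R), fun g hg => ?_⟩
  set u := (Q.comp (restrict Cᶜ hC.compl + ε • (restrict C hC).comp R)) g with hu
  have hu1 : u = (restrict Cᶜ hC.compl + ε • (restrict C hC).comp R) g
      + taboo P R ε c C hC Ψ one u := hQ _
  have huw : ∀ w, u w = ((restrict Cᶜ hC.compl + ε • (restrict C hC).comp R) g) w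
      + taboo P R ε c C hC Ψ one u w := fun w => by
    conv_lhs => rw [hu1]
    rfl
  -- The defect of the Poisson equation; the rest of the proof shows `e = 0`, by way of `y = R e`.
  set e := u - P u - g with he
  have he_off : ∀ w, w ∉ C → e w = 0 := by
    intro w hw
    have := huw w
    rw [taboo_apply_notMem _ hw] at this
    simp [hw] at this
    simp [he, this]
  set y := R e with hy
  have hy1 : y = e + ε • P y := hR e
  have hyw : ∀ w, y w = e w + ε * P y w := fun w => by
    conv_lhs => rw [hy1]
    rfl
  -- `ε R (1 - P) = 1 - (1 - ε) R`
  have hres : ε • R (u - P u) = u - (1 - ε) • R u := by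
    have h1 : ε • (u - P u) = (u - ε • P u) - (1 - ε) • u := by
      rw [smul_sub, sub_smul, one_smul]; abel
    rw [← map_smul, h1, map_sub, hR', map_smul]
  -- On `C` the resolvent identity cancels everything except the subtracted rank-one part, so `y` is
  -- there a constant multiple of `one`.
  have hy_on : ∀ w, w ∈ C → ε * y w = - (Ψ u * c) * one w := by
    intro w hw
    have h1 := huw w
    rw [taboo_apply_mem _ hw] at h1
    simp [hw] at h1
    have h2 : ε • y = u - (1 - ε) • R u - ε • R g := by
      rw [hy, he, map_sub, smul_sub, hres]
    have h3 : ε * y w = u w - (1 - ε) * R u w - ε * R g w := by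
      rw [← smul_apply, h2]; rfl
    rw [h3, h1]; ring
  set T : BoundedMeasurable S →L[ℝ] BoundedMeasurable S := (restrict Cᶜ hC.compl).comp (ε • P)
    with hT
  have hTpos : IsPos T := by
    intro x hx w
    by_cases hw : w ∈ C
    · simp [hT, hw]
    · simp [hT, hw, mul_nonneg hε0.le (hP x hx w)]
  have hTn : ‖T‖ < 1 := by
    refine lt_of_le_of_lt (ContinuousLinearMap.opNorm_comp_le _ _) ?_
    have : ‖restrict Cᶜ hC.compl‖ ≤ 1 := LinearMap.mkContinuous_norm_le _ zero_le_one _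
    have h0 := norm_nonneg (ε • P)
    nlinarith
  -- Off `C` the defect vanishes, so `y = ε P y` there. Hence `y` is determined by its values on
  -- `C`, and must be a multiple of the function `z` that equals `one` on `C` and solves the same
  -- equation off `C`.
  obtain ⟨Z, hZ, -⟩ := exists_resolvent T hTn
  set z := Z (restrict C hC one) with hz
  have hz1 : z = restrict C hC one + T z := hZ _
  have hz0 : ∀ w, 0 ≤ z w := hTpos.nonneg_of_eq_add hTn
    (fun w => by by_cases hw : w ∈ C <;> simp [hw, hone]) hz1
  have hzw : ∀ w, z w = C.indicator one w + T z w := fun w => by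
    conv_lhs => rw [hz1]
    rfl
  set a := Ψ u * c / ε with ha
  have hyz : y + a • z = 0 := by
    refine eq_zero_of_eq_apply hTn (BoundedMeasurable.ext fun w => ?_)
    rw [add_apply, smul_apply, map_add, map_smul, add_apply, smul_apply, hzw w]
    by_cases hw : w ∈ C
    · have h1 := hy_on w hw
      have : y w = - a * one w := by
        rw [ha]; field_simp; linarith
      simp [hT, hw, this]
    · have h1 := hyw w
      rw [he_off w hw, zero_add] at h1
      simp [hT, hw, h1]
  -- Invariance gives `ν e = 0` and `(1 - ε) ν y = ν e`. As `ν z > 0`, the multiple relating `y` to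
  -- `z` must be zero.
  have hνy : ν y = 0 := by
    have h1 : ν y = ν e + ε * ν y := by
      conv_lhs => rw [hy1, map_add, map_smul, hνP, smul_eq_mul]
    have h2 : ν e = 0 := by rw [he, map_sub, map_sub, hνP, hg]; simp
    rw [h2] at h1
    have : (1 - ε) * ν y = 0 := by linarith
    exact (mul_eq_zero.1 this).resolve_left (by linarith)
  have hνz : 0 < ν z := by
    rw [hz1, map_add]
    have := hν0 _ (hTpos z hz0)
    linarith
  have ha0 : a = 0 := by
    have h1 := congrArg ν hyz
    rw [map_add, map_smul, hνy, map_zero, zero_add, smul_eq_mul] at h1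
    exact (mul_eq_zero.1 h1).resolve_right hνz.ne'
  rw [ha0, zero_smul, add_zero] at hyz
  have he0 : e = 0 := by
    rw [hyz] at hy1
    simpa using hy1.symm
  rw [he, sub_sub, sub_eq_zero] at he0
  rw [add_comm]; exact he0

end BoundedMeasurable

/-! ### Invariance, drift and minorization for functions -/

lemma ProbabilityTheory.Kernel.Invariant.integral_integral {S : Type*} [MeasurableSpace S]
    {P : Kernel S S} {ν : Measure S} (hν : Kernel.Invariant P ν) {f : S → ℝ}
    (hf : Integrable f ν) : ∫ w, ∫ w', f w' ∂(P w) ∂ν = ∫ w, f w ∂ν := by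
  have hi : Integrable f ((P ∘ₖ Kernel.const Unit ν) ()) := by
    rw [← Measure.comp_eq_comp_const_apply, hν.def]; exact hf
  have h1 := Kernel.integral_comp hi
  rw [← Measure.comp_eq_comp_const_apply, hν.def, Kernel.const_apply] at h1
  exact h1.symm

/-- A geometric drift condition on `V ≥ 1` towards a set `C` satisfying a minorization condition
for some iterate of the kernel `P`, which has the stationary distribution `ν`. -/
structure DriftMinorization {S : Type*} [MeasurableSpace S] (P : Kernel S S)
    (ν : Measure S) (V : S → ℝ) (C : Set S) (ρ b b₁ : ℝ) (N : ℕ) (φ : Measure S) : Prop where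
  invariant : Kernel.Invariant P ν
  measurable : Measurable V
  one_le : ∀ w, 1 ≤ V w
  integrable_stationary : Integrable V ν
  integrable : ∀ w, Integrable V (P w)
  measurableSet : MeasurableSet C
  rate_nonneg : 0 ≤ ρ
  rate_lt_one : ρ < 1
  bound_pos : 0 < b
  drift : ∀ w, ∫ w', V w' ∂(P w) ≤ ρ * V w + C.indicator (fun _ => b) w
  minor_pos : 0 < b₁
  minorization : ∀ w ∈ C, ∀ A : Set S, MeasurableSet A → ENNReal.ofReal b₁ * φ A ≤ (P ^ N) w A

namespace BoundedMeasurable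

variable {S : Type*} [MeasurableSpace S] {Φ : S → ℝ}

lemma weighted_unit (w : S) : weighted Φ unit w = Φ w := by simp [weighted]

lemma weighted_le_iff (hΦ : ∀ w, 0 < Φ w) {x y : BoundedMeasurable S} {w : S} :
    weighted Φ x w ≤ weighted Φ y w ↔ x w ≤ y w := mul_le_mul_iff_right₀ (hΦ w)

/-- Integrability of the weight under the iterated kernels is not known in advance. Lower integrals
avoid that question, and the finite value on the right-hand side settles it. -/
lemma lintegral_weighted_pow {P : Kernel S S} (hΦm : Measurable Φ)
    (hΦ : ∀ w, 0 < Φ w) (hi : ∀ w, Integrable Φ (P w))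
    {T : BoundedMeasurable S →L[ℝ] BoundedMeasurable S} (hT : IsPos T)
    (hTP : ∀ x w, weighted Φ (T x) w = ∫ w', weighted Φ x w' ∂(P w))
    {x : BoundedMeasurable S} (hx : ∀ w, 0 ≤ x w) (k : ℕ) :
    (∀ w, 0 ≤ (T^[k] x) w) ∧ ∀ w, ∫⁻ w', ENNReal.ofReal (weighted Φ x w') ∂((P ^ k) w) =
      ENNReal.ofReal (weighted Φ (T^[k] x) w) := by
  have hm := (measurable_weighted hΦm x).ennreal_ofReal
  induction k with
  | zero =>
    refine ⟨hx, fun w => ?_⟩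
    rw [pow_zero]
    change ∫⁻ w', ENNReal.ofReal (weighted Φ x w') ∂(Kernel.id w) = _
    rw [Kernel.id_apply, lintegral_dirac' _ hm]
    rfl
  | succ k ih =>
    refine ⟨fun w => by rw [Function.iterate_succ_apply']; exact hT _ ih.1 w, fun w => ?_⟩
    rw [pow_succ]
    change ∫⁻ w', ENNReal.ofReal (weighted Φ x w') ∂(((P ^ k) ∘ₖ P) w) = _
    rw [Kernel.lintegral_comp _ _ _ hm]
    simp_rw [ih.2]
    rw [Function.iterate_succ_apply', hTP, ofReal_integral_eq_lintegral_ofReal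
      (integrable_weighted hΦm hΦ (hi w) _)
      (ae_of_all _ fun w' => (weighted_nonneg_iff hΦ).2 (ih.1 w'))]

/-- `R` is the Neumann series of `ε P`, and by positivity it dominates each single term. This
transfers an `N`-step minorization to the resolvent. -/
lemma pow_smul_iterate_le {P R : BoundedMeasurable S →L[ℝ] BoundedMeasurable S} (hP : IsPos P)
    {ε : ℝ} (hε : 0 ≤ ε) (hR : ∀ x, R x = x + ε • P (R x)) (hRpos : IsPos R)
    {x : BoundedMeasurable S} (hx : ∀ w, 0 ≤ x w) (k : ℕ) (w : S) :
    ε ^ k * (P^[k] x) w ≤ R x w := by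
  have hRw : ∀ w, R x w = x w + ε * P (R x) w := fun w => by
    conv_lhs => rw [hR]
    rfl
  induction k generalizing w with
  | zero =>
    rw [hRw]
    have := hP _ (hRpos x hx) w
    simp only [pow_zero, one_mul, Function.iterate_zero, id]
    nlinarith
  | succ k ih =>
    have h1 := hP.mono (x := ε ^ k • P^[k] x) (y := R x) (fun w => by simpa using ih w) w
    rw [map_smul, smul_apply] at h1
    rw [Function.iterate_succ_apply', hRw, pow_succ']
    have := hx w
    nlinarith [mul_le_mul_of_nonneg_left h1 hε]

end BoundedMeasurable

namespace DriftMinorization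

open BoundedMeasurable

variable {S : Type*} [MeasurableSpace S] {P : Kernel S S} {ν φ : Measure S}
  [IsProbabilityMeasure ν] {V : S → ℝ} {C : Set S} {ρ b b₁ : ℝ} {N : ℕ}

/-- Integrating the drift inequality against `ν` gives `(1 - ρ) ∫ V ≤ b ν(C)`, while `∫ V ≥ 1`. -/
lemma measureReal_pos (h : DriftMinorization P ν V C ρ b b₁ N φ) : 0 < ν.real C := by
  have h1 : ∫ w, V w ∂ν ≤ ρ * ∫ w, V w ∂ν + b * ν.real C := by
    have hi : Integrable (fun w => ∫ w', V w' ∂(P w)) ν := by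
      have h0 : Integrable V ((P ∘ₖ Kernel.const Unit ν) ()) := by
        rw [← Measure.comp_eq_comp_const_apply, h.invariant.def]; exact h.integrable_stationary
      have h1 := h0.integral_comp
      rwa [Kernel.const_apply] at h1
    have hc : Integrable (C.indicator (fun _ => b)) ν := (integrable_const b).indicator h.measurableSet
    calc ∫ w, V w ∂ν = ∫ w, ∫ w', V w' ∂(P w) ∂ν :=
          (h.invariant.integral_integral h.integrable_stationary).symm
      _ ≤ ∫ w, (ρ * V w + C.indicator (fun _ => b) w) ∂ν :=
          integral_mono hi ((h.integrable_stationary.const_mul ρ).add hc) h.drift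
      _ = ρ * ∫ w, V w ∂ν + b * ν.real C := by
          rw [integral_add (h.integrable_stationary.const_mul ρ) hc, integral_const_mul,
            integral_indicator_const b h.measurableSet, smul_eq_mul, mul_comm b]
  have h2 : 1 ≤ ∫ w, V w ∂ν := by
    have := integral_mono (integrable_const (1 : ℝ)) h.integrable_stationary h.one_le
    simpa using this
  have h3 := h.rate_lt_one
  have h4 := h.bound_pos
  by_contra hn
  have : ν.real C = 0 := le_antisymm (not_lt.1 hn) measureReal_nonneg
  rw [this] at h1
  nlinarith

end DriftMinorization

namespace DriftMinorization

open BoundedMeasurable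

variable {S : Type*} [MeasurableSpace S] {P : Kernel S S} {ν φ : Measure S}
  {V : S → ℝ} {C : Set S} {ρ b b₁ : ℝ} {N : ℕ}

lemma integral_add_const [IsMarkovKernel P] (h : DriftMinorization P ν V C ρ b b₁ N φ) (K : ℝ) (w : S) :
    ∫ w', (V w' + K) ∂(P w) ≤ ρ * V w + C.indicator (fun _ => b) w + K := by
  rw [integral_add (h.integrable w) (integrable_const K), integral_const, probReal_univ, one_smul]
  have := h.drift w
  linarith

lemma indicator_le (h : DriftMinorization P ν V C ρ b b₁ N φ) (w : S) :
    C.indicator (fun _ => b) w ≤ b :=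
  Set.indicator_le_self' (fun _ _ => h.bound_pos.le) w

/-- The minorizing measure integrates the weight, and the minorization holds for functions. -/
lemma minorization_weighted [IsProbabilityMeasure ν] (h : DriftMinorization P ν V C ρ b b₁ N φ) {Φ : S → ℝ}
    (hΦm : Measurable Φ) (hΦ : ∀ w, 0 < Φ w) (hi : ∀ w, Integrable Φ (P w))
    {T : BoundedMeasurable S →L[ℝ] BoundedMeasurable S} (hT : IsPos T)
    (hTP : ∀ x w, weighted Φ (T x) w = ∫ w', weighted Φ x w' ∂(P w)) :
    Integrable Φ φ ∧ ∀ x : BoundedMeasurable S, (∀ w, 0 ≤ x w) → ∀ w ∈ C,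
      b₁ * ∫ w', weighted Φ x w' ∂φ ≤ weighted Φ (T^[N] x) w := by
  have hle : ∀ w ∈ C, ENNReal.ofReal b₁ • φ ≤ (P ^ N) w := fun w hw =>
    Measure.le_iff.2 fun A hA => h.minorization w hw A hA
  have key : ∀ x : BoundedMeasurable S, (∀ w, 0 ≤ x w) → ∀ w ∈ C,
      ENNReal.ofReal b₁ * ∫⁻ w', ENNReal.ofReal (weighted Φ x w') ∂φ ≤
        ENNReal.ofReal (weighted Φ (T^[N] x) w) := by
    intro x hx w hw
    rw [← (lintegral_weighted_pow hΦm hΦ hi hT hTP hx N).2 w, ← smul_eq_mul,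
      ← lintegral_smul_measure]
    exact lintegral_mono' (hle w hw) le_rfl
  have hΦφ : Integrable Φ φ := by
    -- A single point of `C` suffices: there the minorization bounds `b₁ ∫ Φ dφ` by a finite number.
    obtain ⟨w, hw⟩ : C.Nonempty := by
      by_contra hne
      have := h.measureReal_pos
      rw [Set.not_nonempty_iff_eq_empty.1 hne] at this
      simp at this
    have h1 := key unit (fun w => by simp) w hw
    refine ⟨hΦm.aestronglyMeasurable, ?_⟩
    rw [hasFiniteIntegral_iff_ofReal (ae_of_all _ fun w => (hΦ w).le)]
    simp_rw [weighted_unit] at h1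
    have h2 := lt_of_le_of_lt h1 ENNReal.ofReal_lt_top
    rcases ENNReal.mul_lt_top_iff.1 h2 with h3 | h3 | h3
    · exact h3.2
    · exact absurd (ENNReal.ofReal_eq_zero.1 h3) (not_le.2 h.minor_pos)
    · rw [h3]; exact ENNReal.zero_lt_top
  refine ⟨hΦφ, fun x hx w hw => ?_⟩
  have h1 := key x hx w hw
  rw [← ofReal_integral_eq_lintegral_ofReal (integrable_weighted hΦm hΦ hΦφ x)
    (ae_of_all _ fun w' => (weighted_nonneg_iff hΦ).2 (hx w')), ← ENNReal.ofReal_mul h.minor_pos.le]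
    at h1
  refine (ENNReal.ofReal_le_ofReal_iff ?_).1 h1
  exact (weighted_nonneg_iff hΦ).2 ((lintegral_weighted_pow hΦm hΦ hi hT hTP hx N).1 w)

/-! ### The Poisson equation in the weighted space -/

variable [IsMarkovKernel P] [IsProbabilityMeasure ν] [IsProbabilityMeasure φ]

/-- The Poisson equation is solvable in a weighted space. -/
lemma exists_weighted_poisson (h : DriftMinorization P ν V C ρ b b₁ N φ) :
    ∃ K : ℝ, 0 ≤ K ∧ ∃ D : BoundedMeasurable S →L[ℝ] BoundedMeasurable S, ∀ g w,
      ∫ w', weighted (fun w => V w + K) g w' ∂ν = 0 →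
        weighted (fun w => V w + K) (D g) w = weighted (fun w => V w + K) g w +
          ∫ w', weighted (fun w => V w + K) (D g) w' ∂(P w) := by
  have hb := h.bound_pos
  have hρ0 := h.rate_nonneg
  have hρ1 := h.rate_lt_one
  have hb1 := h.minor_pos
  -- The kernel operator has weighted norm at most `1 + b`, so this choice gives `‖ε T‖ ≤ 1 / 2`.
  obtain ⟨ε, hε⟩ : ∃ ε : ℝ, ε = 1 / (2 * (1 + b)) := ⟨_, rfl⟩
  have hεb : ε * (1 + b) = 1 / 2 := by rw [hε]; field_simp
  have hε0 : 0 < ε := by rw [hε]; positivity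
  have hε1 : ε < 1 := by nlinarith
  have hερ : 0 < 1 - ε * ρ := by nlinarith
  -- The constants `a` and `d` make `a V + d` a supersolution, `(1 - ε) V ≤ (1 - ε P)(a V + d)`;
  -- applying `R` gives `(1 - ε) R V ≤ a V + d`, with `a < 1`.
  obtain ⟨a, ha⟩ : ∃ a : ℝ, a = (1 - ε) / (1 - ε * ρ) := ⟨_, rfl⟩
  have ha' : a * (1 - ε * ρ) = 1 - ε := by rw [ha]; field_simp
  have ha1 : a < 1 := by rw [ha, div_lt_one hερ]; nlinarith
  have ha0 : 0 < a := by rw [ha]; exact div_pos (by linarith) hερ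
  obtain ⟨d, hd⟩ : ∃ d : ℝ, d = ε * a * b / (1 - ε) := ⟨_, rfl⟩
  have hd' : d * (1 - ε) = ε * a * b := by
    rw [hd]; exact div_mul_cancel₀ _ (by linarith)
  have hd0 : 0 < d := by rw [hd]; exact div_pos (by positivity) (by linarith)
  -- `c` is the one-step minorization constant of `(1 - ε) R` on `C`. With `K = d / c` the
  -- subtracted part, of size at least `c K`, cancels the excess `d` above.
  obtain ⟨c, hc⟩ : ∃ c : ℝ, c = (1 - ε) * ε ^ N * b₁ := ⟨_, rfl⟩
  have hc0 : 0 < c := by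
    rw [hc]; exact mul_pos (mul_pos (by linarith) (pow_pos hε0 N)) hb1
  obtain ⟨K, hK⟩ : ∃ K : ℝ, K = d / c := ⟨_, rfl⟩
  have hK0 : 0 < K := by rw [hK]; positivity
  have hcK : c * K = d := by rw [hK]; field_simp
  refine ⟨K, hK0.le, ?_⟩
  set Φ : S → ℝ := fun w => V w + K with hΦdef
  have hV1 := h.one_le
  have hΦm : Measurable Φ := h.measurable.add_const K
  have hΦ1 : ∀ w, 1 ≤ Φ w := fun w => by have := hV1 w; simp only [hΦdef]; linarith
  have hΦ : ∀ w, 0 < Φ w := fun w => lt_of_lt_of_le one_pos (hΦ1 w)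
  have hi : ∀ w, Integrable Φ (P w) := fun w => (h.integrable w).add (integrable_const K)
  have hiν : Integrable Φ ν := h.integrable_stationary.add (integrable_const K)
  have hPΦ : ∀ w, ∫ w', Φ w' ∂(P w) ≤ (1 + b) * Φ w := fun w => by
    refine (h.integral_add_const K w).trans ?_
    have h1 := h.indicator_le w
    have h2 := hV1 w
    simp only [hΦdef]
    nlinarith
  set T := kernelCLM hΦm hΦ P hi (1 + b) (by linarith) hPΦ with hT
  have hTpos : IsPos T := isPos_kernelCLM hΦm hΦ P hi _ _ hPΦ
  have hTw : ∀ x w, weighted Φ (T x) w = ∫ w', weighted Φ x w' ∂(P w) :=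
    weighted_kernelCLM hΦm hΦ P hi _ _ hPΦ
  have hεT : ‖ε • T‖ < 1 := by
    rw [norm_smul, Real.norm_of_nonneg hε0.le]
    have := norm_kernelCLM_le hΦm hΦ P hi (1 + b) (by linarith) hPΦ
    nlinarith
  have hεTpos : IsPos (ε • T) := fun x hx w => mul_nonneg hε0.le (hTpos x hx w)
  obtain ⟨R, hR, hR'⟩ := exists_resolvent _ hεT
  have hRpos : IsPos R := fun x hx => hεTpos.nonneg_of_eq_add hεT hx (hR x)
  obtain ⟨hΦφ, hminor⟩ := h.minorization_weighted hΦm hΦ hi hTpos hTw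
  set one := ofWeighted hΦm hΦ (fun _ => (1 : ℝ)) measurable_const 1
    (fun w => by simpa using hΦ1 w) with hone
  have honew : ∀ w, weighted Φ one w = 1 := congrFun (weighted_ofWeighted hΦm hΦ _ _ _ _)
  set v := ofWeighted hΦm hΦ V h.measurable 1 (fun w => by
    rw [abs_of_nonneg (by linarith [hV1 w])]; simp only [hΦdef]; linarith) with hv
  have hvw : ∀ w, weighted Φ v w = V w := congrFun (weighted_ofWeighted hΦm hΦ _ _ _ _)
  have hunit : unit = v + K • one := weighted_injective hΦ fun w => by
    rw [weighted_unit, weighted_add, weighted_smul, honew, hvw, mul_one]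
  have hTone : T one = one := weighted_injective hΦ fun w => by
    rw [hTw]; simp [honew]
  have hone0 : ∀ w, 0 ≤ one w := fun w => by
    rw [← weighted_nonneg_iff hΦ, honew]; exact zero_le_one
  have hRone : (1 - ε) • R one = one := by
    have h1 := hR' one
    rw [_root_.smul_apply, hTone] at h1
    rw [← map_smul, sub_smul, one_smul]
    exact h1
  have hRv : ∀ w, (1 - ε) * weighted Φ (R v) w ≤ a * V w + d := by
    intro w
    have h1 : R ((1 - ε) • v) w ≤ R ((a • v + d • one) - (ε • T) (a • v + d • one)) w := by
      refine hRpos.mono (fun w => ?_) w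
      rw [← weighted_le_iff hΦ, weighted_sub, _root_.smul_apply, map_add, map_smul,
        map_smul, hTone]
      simp only [weighted_smul, weighted_add, honew, hvw, hTw]
      have h2 := h.drift w
      have h3 := h.indicator_le w
      have h4 : ε * a * ∫ w', V w' ∂(P w) ≤ ε * a * (ρ * V w + b) :=
        mul_le_mul_of_nonneg_left (by linarith) (by positivity)
      have h5 : a * (1 - ε * ρ) * V w = (1 - ε) * V w := by rw [ha']
      nlinarith
    rw [hR', map_smul, ← weighted_le_iff hΦ] at h1
    simpa only [weighted_smul, weighted_add, honew, hvw, mul_one] using h1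
  set Ψ := integralCLM hΦm hΦ φ hΦφ with hΨ
  have hΨK : K ≤ Ψ unit := by
    simp only [hΨ, integralCLM_apply, weighted_unit]
    have h1 := integral_mono (integrable_const K) hΦφ (fun w => by
      have := hV1 w; simp only [hΦdef]; linarith)
    simpa using h1
  set M := taboo T R ε c C h.measurableSet Ψ one with hM
  have hMpos : IsPos M := by
    intro x hx w
    by_cases hw : w ∈ C
    · rw [hM, taboo_apply_mem _ hw, ← mul_nonneg_iff_of_pos_left (hΦ w)]
      have h1 := hminor x hx w hw
      have h2 := pow_smul_iterate_le hTpos hε0.le hR hRpos hx N w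
      have h3 : ε ^ N * weighted Φ (T^[N] x) w ≤ weighted Φ (R x) w := by
        have := mul_le_mul_of_nonneg_left h2 (hΦ w).le
        simp only [weighted]
        linarith
      -- The minorization of the resolvent, which keeps the taboo operator positive after the
      -- subtraction.
      have h4 : c * Ψ x ≤ (1 - ε) * weighted Φ (R x) w := by
        rw [hc, hΨ, integralCLM_apply, mul_assoc, mul_assoc]
        refine mul_le_mul_of_nonneg_left (le_trans ?_ h3) (by linarith)
        exact mul_le_mul_of_nonneg_left h1 (pow_pos hε0 N).le
      have h5 := honew w
      simp only [weighted] at h4 h5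
      have h6 : Φ w * ((1 - ε) * R x w - Ψ x * (c * one w)) =
        (1 - ε) * (Φ w * R x w) - c * Ψ x * (Φ w * one w) := by ring
      rw [h6, h5]; linarith
    · rw [hM, taboo_apply_notMem _ hw]; exact hTpos x hx w
  set r := max ρ a with hr
  have hr1 : r < 1 := max_lt hρ1 ha1
  have hr0 : 0 ≤ r := hρ0.trans (le_max_left _ _)
  have hMn : ‖M‖ < 1 := by
    -- The weight `V + K` is mapped below `r V + K`, and since `V ≥ 1` this is at most `(r + K) / (1
    -- + K)` times `V + K`.
    refine lt_of_le_of_lt (hMpos.norm_le (r := (r + K) / (1 + K)) (by positivity) fun w => ?_)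
      ((div_lt_one (by linarith)).2 (by linarith))
    have hV := hV1 w
    have h1 : Φ w * M unit w ≤ r * V w + K := by
      by_cases hw : w ∈ C
      · rw [hM, taboo_apply_mem _ hw]
        have h2 : (1 - ε) * R unit w = (1 - ε) * R v w + K * one w := by
          rw [hunit, map_add, map_smul, BoundedMeasurable.add_apply, BoundedMeasurable.smul_apply]
          have h3 : (1 - ε) * R one w = one w := by rw [← BoundedMeasurable.smul_apply, hRone]
          rw [← h3]; ring
        have h3 := hRv w
        have h5 := honew w
        simp only [weighted] at h3 h5
        have h6 : Φ w * ((1 - ε) * R unit w - Ψ unit * (c * one w)) =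
            (1 - ε) * (Φ w * R v w) + K * (Φ w * one w) - c * Ψ unit * (Φ w * one w) := by
          rw [h2]; ring
        rw [h6, h5]
        have h7 : c * K ≤ c * Ψ unit := mul_le_mul_of_nonneg_left hΨK hc0.le
        have h8 : a * V w ≤ r * V w := mul_le_mul_of_nonneg_right (le_max_right _ _) (by linarith)
        linarith
      · rw [hM, taboo_apply_notMem _ hw]
        have h2 := hTw unit w
        simp only [weighted_unit] at h2
        have h3 := h.integral_add_const K w
        rw [Set.indicator_of_notMem hw] at h3
        have h8 : ρ * V w ≤ r * V w := mul_le_mul_of_nonneg_right (le_max_left _ _) (by linarith)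
        change weighted Φ (T unit) w ≤ _
        rw [h2]
        simp only [hΦdef]
        linarith
    have h2 : r * V w + K ≤ (r + K) / (1 + K) * Φ w := by
      rw [div_mul_eq_mul_div, le_div_iff₀ (by linarith)]
      simp only [hΦdef]
      nlinarith [mul_nonneg hK0.le (sub_nonneg.2 hr1.le), mul_nonneg (mul_nonneg hK0.le (sub_nonneg.2 hr1.le)) (sub_nonneg.2 hV)]
    have h3 := h1.trans h2
    rw [mul_comm] at h3
    exact le_of_mul_le_mul_right h3 (hΦ w)
  obtain ⟨D, hD⟩ := exists_poisson_of_norm_taboo_lt_one (ν := integralCLM hΦm hΦ ν hiν) hTpos hε0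
    hε1 hεT hR hR' h.measurableSet hone0 hMn
    (fun x => by
      simp only [integralCLM_apply, hTw]
      exact h.invariant.integral_integral (integrable_weighted hΦm hΦ hiν x))
    (fun x hx => integral_nonneg fun w => (weighted_nonneg_iff hΦ).2 (hx w))
    (by
      have h1 : weighted Φ (restrict C h.measurableSet one) = C.indicator (fun _ => (1 : ℝ)) := by
        funext w
        by_cases hw : w ∈ C
        · simpa [weighted, hw] using honew w
        · simp [weighted, hw]
      rw [integralCLM_apply, h1, integral_indicator_const _ h.measurableSet, smul_eq_mul, mul_one]
      exact h.measureReal_pos)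
  refine ⟨D, fun g w hg => ?_⟩
  conv_lhs => rw [hD g hg]
  rw [weighted_add, hTw]

/-- A bounded solution operator of the Poisson equation `u - P u = f - ν f` on the functions
dominated by `V`. -/
theorem exists_poisson (h : DriftMinorization P ν V C ρ b b₁ N φ) :
    ∃ K : ℝ, 0 ≤ K ∧ ∃ T : (S → ℝ) → S → ℝ,
      (∀ f c, 0 ≤ c → Measurable f → (∀ w, |f w| ≤ c * V w) →
        Measurable (T f) ∧ (∀ w, |T f w| ≤ K * c * V w) ∧
        (∫ w, f w ∂ν = 0 → ∀ w, T f w = f w + ∫ w', T f w' ∂(P w))) ∧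
      ∀ f g c, 0 ≤ c → Measurable f → Measurable g → (∀ w, |f w| ≤ c * V w) →
        (∀ w, |g w| ≤ c * V w) → ∀ w, T (fun w => f w - g w) w = T f w - T g w := by
  classical
  obtain ⟨K, hK0, D, hD⟩ := h.exists_weighted_poisson
  set Φ : S → ℝ := fun w => V w + K with hΦdef
  have hV1 := h.one_le
  have hΦm : Measurable Φ := h.measurable.add_const K
  have hΦ : ∀ w, 0 < Φ w := fun w => by have := hV1 w; simp only [hΦdef]; linarith
  have hVΦ : ∀ c, 0 ≤ c → ∀ w, c * V w ≤ c * Φ w := fun c hc w =>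
    mul_le_mul_of_nonneg_left (by simp only [hΦdef]; linarith) hc
  -- The value `0` outside the dominated measurable functions is a default. The bound picked by
  -- choice is harmless, because the represented function does not depend on it.
  let emb : (S → ℝ) → BoundedMeasurable S := fun f =>
    if hf : Measurable f ∧ ∃ c, ∀ w, |f w| ≤ c * Φ w then
      ofWeighted hΦm hΦ f hf.1 hf.2.choose hf.2.choose_spec else 0
  have hemb : ∀ f c, 0 ≤ c → Measurable f → (∀ w, |f w| ≤ c * V w) →
      weighted Φ (emb f) = f ∧ ‖emb f‖ ≤ c := by
    intro f c hc hfm hf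
    have h0 : Measurable f ∧ ∃ c, ∀ w, |f w| ≤ c * Φ w :=
      ⟨hfm, c, fun w => (hf w).trans (hVΦ c hc w)⟩
    have h1 : weighted Φ (emb f) = f := by
      simp only [emb, dif_pos h0]
      exact weighted_ofWeighted hΦm hΦ _ _ _ _
    refine ⟨h1, norm_le hc fun w => ?_⟩
    have h2 : |weighted Φ (emb f) w| ≤ c * Φ w := by rw [h1]; exact (hf w).trans (hVΦ c hc w)
    rw [weighted, abs_mul, abs_of_pos (hΦ w), mul_comm] at h2
    exact le_of_mul_le_mul_right h2 (hΦ w)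
  -- The factor `1 + K` converts the weight `V + K` back to `V`, using `V ≥ 1`.
  refine ⟨‖D‖ * (1 + K), by positivity, fun f => weighted Φ (D (emb f)), ?_, ?_⟩
  · intro f c hc hfm hf
    obtain ⟨h1, h2⟩ := hemb f c hc hfm hf
    refine ⟨measurable_weighted hΦm _, fun w => ?_, fun hint w => ?_⟩
    · refine (abs_weighted_le hΦ _ w).trans ?_
      have h3 : ‖D (emb f)‖ ≤ ‖D‖ * c := (D.le_opNorm _).trans
        (mul_le_mul_of_nonneg_left h2 (norm_nonneg _))
      have h4 : Φ w ≤ (1 + K) * V w := by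
        have := hV1 w; simp only [hΦdef]; nlinarith
      calc ‖D (emb f)‖ * Φ w ≤ (‖D‖ * c) * ((1 + K) * V w) :=
            mul_le_mul h3 h4 (hΦ w).le (by positivity)
        _ = _ := by ring
    · have h3 := hD (emb f) w (by rw [h1]; exact hint)
      rw [h1] at h3
      exact h3
  · intro f g c hc hfm hgm hf hg w
    have h1 := hemb f c hc hfm hf
    have h2 := hemb g c hc hgm hg
    have h3 := hemb (fun w => f w - g w) (c + c) (by positivity) (hfm.sub hgm) (fun w =>
      (abs_sub _ _).trans (by have := hf w; have := hg w; linarith))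
    have h4 : emb (fun w => f w - g w) = emb f - emb g := weighted_injective hΦ fun w => by
      rw [weighted_sub, h1.1, h2.1, h3.1]
    simp only [h4, map_sub, weighted_sub]

end DriftMinorization

/-! ### Consequences of the drift condition -/

/-- A stationary distribution integrates a function satisfying a geometric drift condition. -/
lemma ProbabilityTheory.Kernel.Invariant.integrable_of_drift {S : Type*} [MeasurableSpace S]
    {P : Kernel S S} [IsMarkovKernel P] {ν : Measure S} [IsProbabilityMeasure ν]
    (hν : Kernel.Invariant P ν) {U : S → ℝ} (hU : Measurable U) (hU0 : ∀ w, 0 ≤ U w) {ρ b : ℝ}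
    (hρ0 : 0 ≤ ρ) (hρ1 : ρ < 1) (hb : 0 ≤ b)
    (hd : ∀ w, ∫⁻ w', ENNReal.ofReal (U w') ∂(P w) ≤ ENNReal.ofReal (ρ * U w + b)) :
    Integrable U ν := by
  have hPi : ∀ w, Integrable U (P w) := fun w => ⟨hU.aestronglyMeasurable, by
    rw [hasFiniteIntegral_iff_ofReal (ae_of_all _ hU0)]
    exact (hd w).trans_lt ENNReal.ofReal_lt_top⟩
  have hPU : ∀ w, ∫ w', U w' ∂(P w) ≤ ρ * U w + b := fun w => by
    have h1 := hd w
    rw [← ofReal_integral_eq_lintegral_ofReal (hPi w) (ae_of_all _ hU0)] at h1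
    exact (ENNReal.ofReal_le_ofReal_iff (add_nonneg (mul_nonneg hρ0 (hU0 w)) hb)).1 h1
  have hbdd : ∀ (g : S → ℝ) (n : ℕ) (μ : Measure S) [IsProbabilityMeasure μ], Measurable g →
      (∀ w, 0 ≤ g w) → Integrable (fun w => min (g w) n) μ := fun g n μ _ hg hg0 =>
    Integrable.of_bound (hg.min measurable_const).aestronglyMeasurable n (ae_of_all _ fun w => by
      rw [Real.norm_of_nonneg (le_min (hg0 w) (Nat.cast_nonneg n))]; exact min_le_right _ _)
  have hcover : AECover ν atTop (fun n : ℕ => {w | U w ≤ n}) :=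
    { ae_eventually_mem := ae_of_all _ fun w => by
        obtain ⟨n, hn⟩ := exists_nat_ge (U w)
        filter_upwards [eventually_ge_atTop n] with k hk
        exact hn.trans (Nat.cast_le.2 hk)
      measurableSet := fun n => measurableSet_le hU measurable_const }
  have hion : ∀ n : ℕ, IntegrableOn U {w | U w ≤ n} ν := fun n =>
    Measure.integrableOn_of_bounded (M := n) (measure_ne_top _ _) hU.aestronglyMeasurable <| by
      filter_upwards [ae_restrict_mem (hcover.measurableSet n)] with w hw
      rw [Real.norm_of_nonneg (hU0 w)]; exact hw
  refine hcover.integrable_of_integral_norm_bounded (b / (1 - ρ)) hion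
    (Eventually.of_forall fun n => ?_)
  simp_rw [Real.norm_of_nonneg (hU0 _)]
  have hDm : Measurable fun w => ρ * U w + b := (hU.const_mul ρ).add_const b
  have hD0 : ∀ w, 0 ≤ ρ * U w + b := fun w => add_nonneg (mul_nonneg hρ0 (hU0 w)) hb
  -- Integrability of `U` is the goal, so invariance is applied to the bounded truncation, using `P
  -- (min U n) ≤ min (ρ U + b) n`.
  have h1 : ∫ w, min (U w) n ∂ν ≤ ∫ w, min (ρ * U w + b) n ∂ν := by
    rw [← hν.integral_integral (hbdd U n ν hU hU0)]
    refine integral_mono_of_nonneg (ae_of_all _ fun w => integral_nonneg fun w' =>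
      le_min (hU0 w') (Nat.cast_nonneg n)) (hbdd _ n ν hDm hD0) (ae_of_all _ fun w => ?_)
    refine le_min ?_ ?_
    · exact (integral_mono (hbdd U n (P w) hU hU0) (hPi w) fun w' => min_le_left _ _).trans (hPU w)
    · refine (integral_mono (hbdd U n (P w) hU hU0) (integrable_const (n : ℝ))
        fun w' => min_le_right _ _).trans ?_
      simp
  -- The difference of the two truncations is at least `(1 - ρ) U - b` where `U ≤ n` and nonnegative
  -- elsewhere. Its integral is nonpositive, which bounds the truncated integrals by `b / (1 - ρ)`.
  have h2 : ∫ w, {w | U w ≤ n}.indicator (fun w => (1 - ρ) * U w - b) w ∂ν ≤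
      ∫ w, (min (U w) n - min (ρ * U w + b) n) ∂ν := by
    refine integral_mono ?_ ((hbdd U n ν hU hU0).sub (hbdd _ n ν hDm hD0)) fun w => ?_
    · exact (integrable_indicator_iff (hcover.measurableSet n)).2
        (((hion n).const_mul _).sub (integrable_const b))
    · by_cases hw : U w ≤ n
      · rw [Set.indicator_of_mem (by exact hw)]
        simp only [min_eq_left hw]
        linarith [min_le_left (ρ * U w + b) (n : ℝ)]
      · rw [Set.indicator_of_notMem (by exact hw)]
        simp only [min_eq_right (not_le.1 hw).le]
        linarith [min_le_right (ρ * U w + b) (n : ℝ)]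
  rw [integral_sub (hbdd U n ν hU hU0) (hbdd _ n ν hDm hD0),
    integral_indicator (hcover.measurableSet n), integral_sub ((hion n).const_mul _)
    (integrable_const b), integral_const_mul, MeasureTheory.setIntegral_const, smul_eq_mul] at h2
  have h3 : ν.real {w | U w ≤ n} ≤ 1 := measureReal_le_one
  rw [le_div_iff₀ (by linarith)]
  nlinarith

/-! ### The square-root weight -/

section

variable {E : Type*} [NormedAddCommGroup E] {𝒲 : Set E}

/-- The square root of the Lyapunov function `1 + ‖w‖ ^ 2`. -/
noncomputable def lyapunovSqrt (w : 𝒲) : ℝ := √(1 + ‖(w : E)‖ ^ 2)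

lemma lyapunovSqrt_sq (w : 𝒲) : lyapunovSqrt w ^ 2 = 1 + ‖(w : E)‖ ^ 2 :=
  Real.sq_sqrt (by positivity)

lemma one_le_lyapunovSqrt (w : 𝒲) : 1 ≤ lyapunovSqrt w :=
  Real.one_le_sqrt.2 (by nlinarith [norm_nonneg (w : E)])

lemma one_add_norm_le_lyapunovSqrt (w : 𝒲) : 1 + ‖(w : E)‖ ≤ 2 * lyapunovSqrt w := by
  have h1 := lyapunovSqrt_sq w
  have h2 := one_le_lyapunovSqrt w
  have h3 : ‖(w : E)‖ ≤ lyapunovSqrt w := abs_le_of_sq_le_sq' (by linarith) (by linarith) |>.2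
  linarith

variable [MeasurableSpace E]

lemma measurable_lyapunovSqrt [BorelSpace E] : Measurable (lyapunovSqrt (𝒲 := 𝒲)) := by
  have h1 : Measurable (fun w : 𝒲 => ‖(w : E)‖) :=
    (continuous_norm.measurable).comp measurable_subtype_coe
  exact ((h1.pow_const 2).const_add 1).sqrt

lemma IsGeometricallyErgodicChain.exists_drift {P : Kernel 𝒲 𝒲} {ν : Measure 𝒲}
    (h : IsGeometricallyErgodicChain P ν 2) :
    ∃ (C : Set 𝒲) (ρ b b₁ : ℝ) (N : ℕ) (φ : Measure 𝒲), MeasurableSet C ∧ 0 ≤ ρ ∧ ρ < 1 ∧ 0 < b ∧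
      (∀ w, ∫⁻ w', ENNReal.ofReal (lyapunovSqrt w' ^ 2) ∂(P w) ≤
        ENNReal.ofReal (ρ * lyapunovSqrt w ^ 2 + C.indicator (fun _ => b) w)) ∧
      0 < b₁ ∧ IsProbabilityMeasure φ ∧
      ∀ w ∈ C, ∀ A : Set 𝒲, MeasurableSet A → ENNReal.ofReal b₁ * φ A ≤ (P ^ N) w A := by
  obtain ⟨C, hC, ⟨N, -, b₁, hb₁, φ, hφ, hmin⟩, ρ, hρ0, hρ1, b, hb, hd⟩ := h.minorization_drift
  refine ⟨C, ρ, b, b₁, N, φ, hC, hρ0, hρ1, hb, fun w => ?_, hb₁, hφ, hmin⟩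
  simpa only [lyapunovSqrt_sq, Real.rpow_two] using hd w

/-- The drift condition for `1 + ‖w‖ ^ 2` passes to its square root. -/
lemma integral_lyapunovSqrt_le [BorelSpace E] {P : Kernel 𝒲 𝒲} [IsMarkovKernel P] {C : Set 𝒲}
    {ρ b : ℝ} (hρ : 0 ≤ ρ) (hb : 0 < b) (w : 𝒲)
    (hd : ∫⁻ w', ENNReal.ofReal (lyapunovSqrt w' ^ 2) ∂(P w) ≤
        ENNReal.ofReal (ρ * lyapunovSqrt w ^ 2 + C.indicator (fun _ => b) w)) :
    Integrable (lyapunovSqrt (𝒲 := 𝒲)) (P w) ∧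
      ∫ w', lyapunovSqrt w' ∂(P w) ≤ √ρ * lyapunovSqrt w + C.indicator (fun _ => √b) w := by
  have hV1 := one_le_lyapunovSqrt (𝒲 := 𝒲)
  have hVm := measurable_lyapunovSqrt (𝒲 := 𝒲)
  have hi2 : Integrable (fun w' => lyapunovSqrt w' ^ 2) (P w) :=
    ⟨(hVm.pow_const 2).aestronglyMeasurable, by
      rw [hasFiniteIntegral_iff_ofReal (ae_of_all _ fun w => sq_nonneg _)]
      exact hd.trans_lt ENNReal.ofReal_lt_top⟩
  have hi : Integrable (lyapunovSqrt (𝒲 := 𝒲)) (P w) :=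
    hi2.mono' hVm.aestronglyMeasurable (ae_of_all _ fun w' => by
      have := hV1 w'
      rw [Real.norm_of_nonneg (by linarith)]; nlinarith)
  have hind : 0 ≤ C.indicator (fun _ => b) w := Set.indicator_nonneg (fun _ _ => hb.le) w
  set s := √(ρ * lyapunovSqrt w ^ 2 + C.indicator (fun _ => b) w) with hs
  have hs2 : s ^ 2 = ρ * lyapunovSqrt w ^ 2 + C.indicator (fun _ => b) w :=
    Real.sq_sqrt (by positivity)
  have h2 : ∫ w', lyapunovSqrt w' ^ 2 ∂(P w) ≤ s ^ 2 := by
    rw [← ofReal_integral_eq_lintegral_ofReal hi2 (ae_of_all _ fun w => sq_nonneg _), ← hs2] at hd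
    exact (ENNReal.ofReal_le_ofReal_iff (sq_nonneg _)).1 hd
  have h3 : 1 ≤ s ^ 2 := by
    refine le_trans ?_ h2
    have := integral_mono (integrable_const (1 : ℝ)) hi2 (fun w' => by
      have := hV1 w'; change 1 ≤ lyapunovSqrt w' ^ 2; nlinarith)
    simpa using this
  have hs0 : 0 < s := by
    have := Real.sqrt_nonneg (ρ * lyapunovSqrt w ^ 2 + C.indicator (fun _ => b) w)
    rw [← hs] at this
    nlinarith
  refine ⟨hi, ?_⟩
  have h4 : ∫ w', lyapunovSqrt w' ∂(P w) ≤ s := by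
    -- Jensen's inequality for the square root, through the tangent-line bound `v ≤ (v ^ 2 + s ^ 2)
    -- / (2 s)`.
    have h5 : ∫ w', lyapunovSqrt w' ∂(P w) ≤ ∫ w', (lyapunovSqrt w' ^ 2 + s ^ 2) / (2 * s) ∂(P w) := by
      refine integral_mono hi ((hi2.add (integrable_const _)).div_const _) fun w' => ?_
      rw [le_div_iff₀ (by positivity)]
      nlinarith [sq_nonneg (lyapunovSqrt w' - s)]
    refine h5.trans ?_
    rw [integral_div, integral_add hi2 (integrable_const _), integral_const, probReal_univ, one_smul,
      div_le_iff₀ (by positivity)]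
    nlinarith
  refine h4.trans ?_
  refine abs_le_of_sq_le_sq' ?_ (add_nonneg (mul_nonneg (Real.sqrt_nonneg _) (by linarith [hV1 w]))
    (Set.indicator_nonneg (fun _ _ => Real.sqrt_nonneg _) w)) |>.2
  rw [hs2]
  have hρs := Real.sq_sqrt hρ
  have hbs := Real.sq_sqrt hb.le
  have := hV1 w
  by_cases hw : w ∈ C
  · simp only [Set.indicator_of_mem hw]
    nlinarith [mul_nonneg (mul_nonneg (Real.sqrt_nonneg ρ) (Real.sqrt_nonneg b)) (by linarith : 0 ≤ lyapunovSqrt w)]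
  · simp only [Set.indicator_of_notMem hw]
    nlinarith

end

/-! ### The one-step Markov property and moments of the chain -/

section

/-- Extension of a history to a trajectory, constant after the last time. -/
def extendHistory {S : Type*} (t : ℕ) (x : (i : Finset.Iic t) → S) (i : ℕ) : S :=
  if h : i ≤ t then x ⟨i, Finset.mem_Iic.2 h⟩ else x ⟨t, Finset.mem_Iic.2 le_rfl⟩

lemma DependsOn.extendHistory_frestrictLe {S α : Type*} {Z : (ℕ → S) → α} {t : ℕ}
    (hZ : DependsOn Z (Set.Iic t)) (W : ℕ → S) :
    Z (extendHistory t (Preorder.frestrictLe t W)) = Z W := by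
  refine hZ fun i hi => ?_
  have hi' : i ≤ t := hi
  simp [extendHistory, hi']

variable {S : Type*} [MeasurableSpace S] {P : Kernel S S} [IsMarkovKernel P]

instance isProbabilityMeasure_chainLaw (w : S) : IsProbabilityMeasure (chainLaw P w) := by
  unfold chainLaw; infer_instance

/-- The transition kernel of the chain as a kernel on histories. -/
noncomputable def historyKernel (P : Kernel S S) (t : ℕ) : Kernel ((i : Finset.Iic t) → S) S :=
  P.comap (fun x : (i : Finset.Iic t) → S => x ⟨t, Finset.mem_Iic.2 le_rfl⟩) (measurable_pi_apply _)

instance (t : ℕ) : IsMarkovKernel (historyKernel P t) := by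
  unfold historyKernel; infer_instance

/-- The Ionescu-Tulcea construction read at a single step; the Markov property in both its forms
rests on this identity. -/
lemma map_chainLaw (w : S) (t : ℕ) :
    (chainLaw P w).map (fun W => (Preorder.frestrictLe t W, W (t + 1))) =
      ((chainLaw P w).map (Preorder.frestrictLe t)) ⊗ₘ (historyKernel P t) := by
  have h := Kernel.partialTraj_compProd_eq_map_traj (X := fun _ : ℕ => S) (κ := historyKernel P)
    (a := 0) (b := t) (Nat.zero_le t) (x₀ := fun _ => w)
  rw [← Kernel.traj_map_frestrictLe_apply] at h
  exact h.symm

lemma measurable_extendHistory (t : ℕ) :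
    Measurable (extendHistory t : ((i : Finset.Iic t) → S) → ℕ → S) := by
  refine measurable_pi_lambda _ fun i => ?_
  by_cases h : i ≤ t
  · simp only [extendHistory, h, dif_pos]; exact measurable_pi_apply _
  · simp only [extendHistory, h]; exact measurable_pi_apply _

variable {α : Type*} [MeasurableSpace α]

/-- The one-step Markov property for nonnegative functions. -/
lemma lintegral_chainLaw_succ (w : S) {t : ℕ} {Z : (ℕ → S) → α} (hZm : Measurable Z)
    (hZ : DependsOn Z (Set.Iic t)) {g : α × S → ENNReal} (hg : Measurable g) :
    ∫⁻ W, g (Z W, W (t + 1)) ∂(chainLaw P w) =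
      ∫⁻ W, ∫⁻ y, g (Z W, y) ∂(P (W t)) ∂(chainLaw P w) := by
  have hm : Measurable fun p : ((i : Finset.Iic t) → S) × S => g (Z (extendHistory t p.1), p.2) :=
    hg.comp ((hZm.comp ((measurable_extendHistory t).comp measurable_fst)).prodMk measurable_snd)
  have h1 : ∫⁻ W, g (Z W, W (t + 1)) ∂(chainLaw P w) =
      ∫⁻ p, g (Z (extendHistory t p.1), p.2) ∂((chainLaw P w).map
        (fun W => (Preorder.frestrictLe t W, W (t + 1)))) := by
    rw [lintegral_map hm ((Preorder.measurable_frestrictLe t).prodMk (measurable_pi_apply _))]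
    simp_rw [hZ.extendHistory_frestrictLe]
  rw [h1, map_chainLaw, Measure.lintegral_compProd hm,
    lintegral_map hm.lintegral_kernel_prod_right' (Preorder.measurable_frestrictLe t)]
  simp_rw [hZ.extendHistory_frestrictLe]
  rfl

/-- The one-step Markov property for integrable functions. -/
lemma integral_chainLaw_succ (w : S) {t : ℕ} {Z : (ℕ → S) → α} (hZm : Measurable Z)
    (hZ : DependsOn Z (Set.Iic t)) {g : α × S → ℝ} (hg : Measurable g)
    (hgi : Integrable (fun W => g (Z W, W (t + 1))) (chainLaw P w)) :
    ∫ W, g (Z W, W (t + 1)) ∂(chainLaw P w) =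
      ∫ W, ∫ y, g (Z W, y) ∂(P (W t)) ∂(chainLaw P w) ∧
    Integrable (fun W => ∫ y, g (Z W, y) ∂(P (W t))) (chainLaw P w) := by
  have hm : Measurable fun p : ((i : Finset.Iic t) → S) × S => g (Z (extendHistory t p.1), p.2) :=
    hg.comp ((hZm.comp ((measurable_extendHistory t).comp measurable_fst)).prodMk measurable_snd)
  have hm2 : Measurable fun W : ℕ → S => (Preorder.frestrictLe (π := fun _ => S) t W, W (t + 1)) :=
    (Preorder.measurable_frestrictLe t).prodMk (measurable_pi_apply _)
  have h1 : ∫ W, g (Z W, W (t + 1)) ∂(chainLaw P w) =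
      ∫ p, g (Z (extendHistory t p.1), p.2) ∂((chainLaw P w).map
        (fun W => (Preorder.frestrictLe t W, W (t + 1)))) := by
    rw [integral_map hm2.aemeasurable hm.aestronglyMeasurable]
    simp_rw [hZ.extendHistory_frestrictLe]
  have hi : Integrable (fun p : ((i : Finset.Iic t) → S) × S => g (Z (extendHistory t p.1), p.2))
      ((chainLaw P w).map (fun W => (Preorder.frestrictLe t W, W (t + 1)))) := by
    rw [integrable_map_measure hm.aestronglyMeasurable hm2.aemeasurable]
    refine hgi.congr (ae_of_all _ fun W => ?_)
    simp only [Function.comp, hZ.extendHistory_frestrictLe]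
  rw [map_chainLaw] at hi
  have hk := (hm.stronglyMeasurable.integral_kernel_prod_right' (κ := historyKernel P t))
  constructor
  · rw [h1, map_chainLaw, Measure.integral_compProd hi,
      integral_map (Preorder.measurable_frestrictLe t).aemeasurable hk.aestronglyMeasurable]
    simp_rw [hZ.extendHistory_frestrictLe]
    rfl
  · have h2 : Integrable (fun x => ∫ y, g (Z (extendHistory t x), y) ∂(historyKernel P t x))
        ((chainLaw P w).map (Preorder.frestrictLe t)) :=
      Integrable.integral_compProd (κ := Kernel.const Unit _)
        (η := Kernel.prodMkLeft Unit (historyKernel P t)) (a := ()) hi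
    rw [integrable_map_measure hk.aestronglyMeasurable
      (Preorder.measurable_frestrictLe t).aemeasurable] at h2
    refine h2.congr (ae_of_all _ fun W => ?_)
    simp only [Function.comp, hZ.extendHistory_frestrictLe]
    rfl

lemma lintegral_chainLaw_zero (w : S) {f : S → ENNReal} (hf : Measurable f) :
    ∫⁻ W, f (W 0) ∂(chainLaw P w) = f w := by
  have hm : Measurable fun x : (i : Finset.Iic 0) → S => f (x ⟨0, Finset.mem_Iic.2 le_rfl⟩) :=
    hf.comp (measurable_pi_apply _)
  have h1 : (chainLaw P w).map (Preorder.frestrictLe 0) =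
      Measure.dirac (fun _ : Finset.Iic 0 => w) := by
    have h := Kernel.traj_map_frestrictLe_apply (X := fun _ : ℕ => S) (κ := historyKernel P)
      0 0 (fun _ => w)
    rw [Kernel.partialTraj_self, Kernel.id_apply] at h
    exact h
  have h2 := lintegral_map hm (Preorder.measurable_frestrictLe (X := fun _ : ℕ => S) 0)
    (μ := chainLaw P w)
  rw [h1, lintegral_dirac' _ hm] at h2
  exact h2.symm

/-- A geometric drift condition bounds the moments of the chain uniformly in time. -/
lemma exists_moment_bound {U : S → ℝ} (hU : Measurable U) (hU0 : ∀ w, 0 ≤ U w) {ρ b : ℝ}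
    (hρ0 : 0 ≤ ρ) (hρ1 : ρ < 1) (hb : 0 ≤ b)
    (hd : ∀ w, ∫⁻ w', ENNReal.ofReal (U w') ∂(P w) ≤ ENNReal.ofReal (ρ * U w + b)) (w : S) :
    ∃ M, 0 ≤ M ∧ ∀ t, Integrable (fun W => U (W t)) (chainLaw P w) ∧
      ∫ W, U (W t) ∂(chainLaw P w) ≤ M := by
  -- Chosen so that `U w ≤ M` and `ρ M + b ≤ M`, whence the bound propagates in time.
  set M := U w + b / (1 - ρ) with hM
  have hbρ : 0 ≤ b / (1 - ρ) := div_nonneg hb (by linarith)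
  have hM0 : 0 ≤ M := add_nonneg (hU0 w) hbρ
  have hMb : ρ * M + b ≤ M := by
    have h1 : b / (1 - ρ) * (1 - ρ) = b := div_mul_cancel₀ _ (by linarith)
    have := hU0 w
    nlinarith
  have hUe : Measurable fun w => ENNReal.ofReal (U w) := hU.ennreal_ofReal
  have key : ∀ t, ∫⁻ W, ENNReal.ofReal (U (W t)) ∂(chainLaw P w) ≤ ENNReal.ofReal M := by
    intro t
    induction t with
    | zero =>
      rw [lintegral_chainLaw_zero w hUe]
      exact ENNReal.ofReal_le_ofReal (by linarith)
    | succ t ih =>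
      rw [lintegral_chainLaw_succ (α := Unit) w (Z := fun _ => ()) measurable_const
        (fun _ _ _ => rfl) (g := fun p => ENNReal.ofReal (U p.2)) (hUe.comp measurable_snd)]
      calc ∫⁻ W, ∫⁻ y, ENNReal.ofReal (U y) ∂(P (W t)) ∂(chainLaw P w)
          ≤ ∫⁻ W, (ENNReal.ofReal ρ * ENNReal.ofReal (U (W t)) + ENNReal.ofReal b)
              ∂(chainLaw P w) := lintegral_mono fun W => (hd (W t)).trans_eq (by
            rw [ENNReal.ofReal_add (mul_nonneg hρ0 (hU0 _)) hb, ENNReal.ofReal_mul hρ0])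
        _ = ENNReal.ofReal ρ * ∫⁻ W, ENNReal.ofReal (U (W t)) ∂(chainLaw P w) +
              ENNReal.ofReal b := by
            rw [lintegral_add_right _ measurable_const,
              lintegral_const_mul' _ _ ENNReal.ofReal_ne_top]
            simp
        _ ≤ ENNReal.ofReal ρ * ENNReal.ofReal M + ENNReal.ofReal b := by gcongr
        _ = ENNReal.ofReal (ρ * M + b) := by
            rw [ENNReal.ofReal_add (mul_nonneg hρ0 hM0) hb, ENNReal.ofReal_mul hρ0]
        _ ≤ _ := ENNReal.ofReal_le_ofReal hMb
  refine ⟨M, hM0, fun t => ?_⟩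
  have hi : Integrable (fun W => U (W t)) (chainLaw P w) :=
    ⟨(hU.comp (measurable_pi_apply t)).aestronglyMeasurable, by
      rw [hasFiniteIntegral_iff_ofReal (ae_of_all _ fun W => hU0 _)]
      exact (key t).trans_lt ENNReal.ofReal_lt_top⟩
  refine ⟨hi, ?_⟩
  have h1 := key t
  rw [← ofReal_integral_eq_lintegral_ofReal hi (ae_of_all _ fun W => hU0 _)] at h1
  exact (ENNReal.ofReal_le_ofReal_iff hM0).1 h1

end

/-! ### Projection onto a ball -/

section

variable {d : ℕ} {B : ℝ}

lemma ballProj_of_norm_le {x : EuclideanSpace ℝ (Fin d)} (hx : ‖x‖ ≤ B) : ballProj B x = x :=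
  if_pos hx

lemma norm_ballProj_le (hB : 0 < B) (x : EuclideanSpace ℝ (Fin d)) : ‖ballProj B x‖ ≤ B := by
  unfold ballProj
  split_ifs with h
  · exact h
  · have hx : 0 < ‖x‖ := hB.trans (not_le.1 h)
    rw [norm_smul, Real.norm_of_nonneg (by positivity), div_mul_cancel₀ _ hx.ne']

/-- The obtuse-angle property: outside the ball the residual is a nonnegative multiple of `x`, and
`⟪x, y⟫ ≤ B ‖x‖ = ⟪x, ballProj B x⟫`. -/
lemma inner_sub_ballProj_nonpos (hB : 0 < B) (x : EuclideanSpace ℝ (Fin d))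
    {y : EuclideanSpace ℝ (Fin d)} (hy : ‖y‖ ≤ B) :
    inner ℝ (x - ballProj B x) (y - ballProj B x) ≤ 0 := by
  by_cases h : ‖x‖ ≤ B
  · simp [ballProj_of_norm_le h]
  · have hx : 0 < ‖x‖ := hB.trans (not_le.1 h)
    have hP : ballProj B x = (B / ‖x‖) • x := if_neg h
    have h1 : x - ballProj B x = (1 - B / ‖x‖) • x := by rw [hP, sub_smul, one_smul]
    have h2 : 0 ≤ 1 - B / ‖x‖ := by
      rw [sub_nonneg, div_le_one hx]; exact (not_le.1 h).le
    have h3 : inner ℝ x (y - ballProj B x) ≤ 0 := by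
      rw [inner_sub_right, hP, inner_smul_right, real_inner_self_eq_norm_sq]
      have h4 : inner ℝ x y ≤ ‖x‖ * B :=
        (real_inner_le_norm x y).trans (mul_le_mul_of_nonneg_left hy (norm_nonneg x))
      have h5 : B / ‖x‖ * ‖x‖ ^ 2 = ‖x‖ * B := by field_simp
      linarith
    rw [h1, real_inner_smul_left]
    exact mul_nonpos_of_nonneg_of_nonpos h2 h3

/-- Adding the obtuse-angle inequalities at both points gives `‖p - q‖ ^ 2 ≤ ⟪x - y, p - q⟫`;
Cauchy-Schwarz finishes. -/
lemma norm_ballProj_sub_ballProj_le (hB : 0 < B) (x y : EuclideanSpace ℝ (Fin d)) :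
    ‖ballProj B x - ballProj B y‖ ≤ ‖x - y‖ := by
  have h1 := inner_sub_ballProj_nonpos hB x (norm_ballProj_le hB y)
  have h2 := inner_sub_ballProj_nonpos hB y (norm_ballProj_le hB x)
  set p := ballProj B x
  set q := ballProj B y
  have h3 : ‖p - q‖ ^ 2 ≤ inner ℝ (x - y) (p - q) := by
    rw [← real_inner_self_eq_norm_sq]
    have h4 : inner ℝ (p - q) (p - q) - inner ℝ (x - y) (p - q) =
        inner ℝ (x - p) (q - p) + inner ℝ (y - q) (p - q) := by
      rw [← inner_sub_left, ← neg_sub p q, inner_neg_right, neg_add_eq_sub, ← inner_sub_left]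
      congr 1; abel
    linarith
  have h4 := real_inner_le_norm (x - y) (p - q)
  by_contra hn
  nlinarith [norm_nonneg (x - y), norm_nonneg (p - q)]

lemma norm_ballProj_sub_le (hB : 0 < B) (x : EuclideanSpace ℝ (Fin d))
    {y : EuclideanSpace ℝ (Fin d)} (hy : ‖y‖ ≤ B) : ‖ballProj B x - y‖ ≤ ‖x - y‖ := by
  have := norm_ballProj_sub_ballProj_le hB x y
  rwa [ballProj_of_norm_le hy] at this

lemma continuous_ballProj (hB : 0 < B) :
    Continuous (ballProj B : EuclideanSpace ℝ (Fin d) → EuclideanSpace ℝ (Fin d)) :=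
  (LipschitzWith.of_dist_le_mul (K := 1) fun x y => by
    simpa [dist_eq_norm] using norm_ballProj_sub_ballProj_le hB x y).continuous

end

/-! ### A real recursion -/

/-- Bernoulli's inequality `(1 + 1 / t) ^ κ ≤ 1 + κ / t` combined with `1 / (1 + s) ≥ 1 - s`. It
bounds how much the target rate shrinks in one step. -/
lemma rpow_neg_sub_le {κ : ℝ} (hκ : 0 < κ) (hκ1 : κ ≤ 1) {t : ℕ} (ht : 1 ≤ t) :
    (t : ℝ) ^ (-κ) * (1 - κ / t) ≤ ((t + 1 : ℕ) : ℝ) ^ (-κ) := by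
  have ht0 : (0 : ℝ) < t := by exact_mod_cast ht
  have h1 : ((t + 1 : ℕ) : ℝ) = t * (1 + 1 / t) := by push_cast; field_simp
  rw [h1, Real.mul_rpow ht0.le (by positivity)]
  refine mul_le_mul_of_nonneg_left ?_ (by positivity)
  have h2 : (1 + 1 / (t : ℝ)) ^ κ ≤ 1 + κ * (1 / t) :=
    rpow_one_add_le_one_add_mul_self (by have : (0 : ℝ) < 1 / t := by positivity
                                         linarith) hκ.le hκ1
  rw [Real.rpow_neg (by positivity)]
  have h3 : 0 < (1 + 1 / (t : ℝ)) ^ κ := by positivity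
  have hs : 0 < κ / t := by positivity
  have h4 : κ * (1 / (t : ℝ)) = κ / t := mul_one_div _ _
  rw [h4] at h2
  rw [← one_div, le_div_iff₀ h3]
  rcases le_total (κ / t) 1 with h5 | h5 <;> nlinarith

lemma rpow_neg_mul_inv_le {κ : ℝ} (hκ1 : κ ≤ 1) {t : ℕ} (ht : 1 ≤ t) :
    (t : ℝ)⁻¹ ≤ (t : ℝ) ^ (-κ) := by
  rw [← Real.rpow_neg_one]
  exact Real.rpow_le_rpow_of_exponent_le (by exact_mod_cast ht) (by linarith)

/-- The contraction gain `q t ^ (-2κ)` must beat the shrinkage `κ t ^ (-κ - 1)` of the target. For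
`κ < 1` the latter is of smaller order; for `κ = 1` the orders agree and `q > 1` is needed. -/
lemma exists_rate {κ q : ℝ} (hκ1 : κ ≤ 1) (hq : 0 < q) (hq1 : κ = 1 → 1 < q) :
    ∃ c, 0 < c ∧ ∀ᶠ t : ℕ in atTop, c * ((t : ℝ) ^ (-κ)) ^ 2 ≤
      q * ((t : ℝ) ^ (-κ)) ^ 2 - (t : ℝ) ^ (-κ) * (κ / t) := by
  rcases eq_or_lt_of_le hκ1 with h | h
  · refine ⟨q - 1, sub_pos.2 (hq1 h), ?_⟩
    filter_upwards with t
    rw [h, Real.rpow_neg_one]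
    refine le_of_eq ?_
    ring
  · refine ⟨q / 2, by positivity, ?_⟩
    have hlim : Tendsto (fun t : ℕ => κ * (t : ℝ) ^ (-(1 - κ))) atTop (nhds (κ * 0)) :=
      ((tendsto_rpow_neg_atTop (by linarith)).comp tendsto_natCast_atTop_atTop).const_mul κ
    rw [mul_zero] at hlim
    filter_upwards [hlim.eventually (gt_mem_nhds (show (0 : ℝ) < q / 2 by positivity)),
      eventually_ge_atTop 1] with t h1 ht
    have ht0 : (0 : ℝ) < t := by exact_mod_cast ht
    have h2 : (t : ℝ) ^ (-κ) * (κ / t) = ((t : ℝ) ^ (-κ)) ^ 2 * (κ * (t : ℝ) ^ (-(1 - κ))) := by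
      have h3 : (t : ℝ)⁻¹ = (t : ℝ) ^ (-κ) * (t : ℝ) ^ (-(1 - κ)) := by
        rw [← Real.rpow_add ht0, ← Real.rpow_neg_one]; congr 1; ring
      rw [div_eq_mul_inv, h3]; ring
    rw [h2]
    nlinarith [mul_le_mul_of_nonneg_left h1.le (sq_nonneg ((t : ℝ) ^ (-κ)))]

/-- Convergence rate of a linear recursion with step sizes `γ₀ t ^ (-κ)` and a telescoping
perturbation. The constants do not depend on the sequences. -/
lemma exists_recursion_bound {κ γ₀ ζ : ℝ} (hκ : 0 < κ) (hκ1 : κ ≤ 1) (hγ : 0 < γ₀) (hζ : 0 < ζ)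
    (hone : κ = 1 → 1 < ζ * γ₀) (t₁ : ℕ) {A₀ CD C : ℝ} (hCD : 0 ≤ CD) (hC : 0 ≤ C) :
    ∃ (K : ℝ) (t₀ : ℕ), 0 ≤ K ∧ t₁ ≤ t₀ ∧ ∀ a D : ℕ → ℝ, (∀ t, 1 ≤ t → a t ≤ A₀) →
      (∀ t, 1 ≤ t → |D t| ≤ CD) →
      (∀ t, 1 ≤ t → t₁ ≤ t → a (t + 1) ≤ (1 - ζ * (γ₀ * (t : ℝ) ^ (-κ))) * a t +
        2 * (γ₀ * (t : ℝ) ^ (-κ)) * (D t - D (t + 1)) + C * ((t : ℝ) ^ (-κ)) ^ 2) →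
      ∀ t, t₀ ≤ t → a t ≤ K * (t : ℝ) ^ (-κ) := by
  obtain ⟨c, hc, hev⟩ := exists_rate hκ1 (mul_pos hζ hγ) hone
  have hlim : Tendsto (fun t : ℕ => ζ * γ₀ * (t : ℝ) ^ (-κ)) atTop (nhds (ζ * γ₀ * 0)) :=
    ((tendsto_rpow_neg_atTop hκ).comp tendsto_natCast_atTop_atTop).const_mul _
  rw [mul_zero] at hlim
  obtain ⟨t₀, ht₀⟩ := eventually_atTop.1 ((hev.and (hlim.eventually (gt_mem_nhds one_pos))).and
    ((eventually_ge_atTop 1).and (eventually_ge_atTop t₁)))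
  -- The two extra terms are the errors of the shifted quantity below: the shift multiplied by the
  -- contraction factor, and the change of the step size from `t` to `t + 1`.
  set C' := C + 2 * ζ * γ₀ ^ 2 * CD + 2 * γ₀ * CD with hC'
  -- The first entry closes the induction step, the second covers the starting time `t₀`.
  set K := max (C' / c) ((A₀ + 2 * γ₀ * CD) * (t₀ : ℝ) ^ κ) with hK
  have hK0 : 0 ≤ K := (div_nonneg (by positivity) hc.le).trans (le_max_left _ _)
  refine ⟨K + 2 * γ₀ * CD, t₀, by positivity, (ht₀ t₀ le_rfl).2.2, fun a D ha hD hrec => ?_⟩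
  -- Shifting by `2 γ_t D t` turns the telescoping perturbation into an error of second order in the
  -- step size.
  have key : ∀ t, t₀ ≤ t → a t + 2 * (γ₀ * (t : ℝ) ^ (-κ)) * D t ≤ K * (t : ℝ) ^ (-κ) := by
    intro t ht
    induction t, ht using Nat.le_induction with
    | base =>
      have h1 := (ht₀ t₀ le_rfl).2.1
      have ht0 : (0 : ℝ) < t₀ := by exact_mod_cast h1
      have h2 : (A₀ + 2 * γ₀ * CD) * (t₀ : ℝ) ^ κ * (t₀ : ℝ) ^ (-κ) = A₀ + 2 * γ₀ * CD := by
        rw [mul_assoc, ← Real.rpow_add ht0]; simp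
      have h3 : (A₀ + 2 * γ₀ * CD) * (t₀ : ℝ) ^ κ * (t₀ : ℝ) ^ (-κ) ≤ K * (t₀ : ℝ) ^ (-κ) :=
        mul_le_mul_of_nonneg_right (le_max_right _ _) (by positivity)
      have h4 : (t₀ : ℝ) ^ (-κ) ≤ 1 :=
        Real.rpow_le_one_of_one_le_of_nonpos (by exact_mod_cast h1) (by linarith)
      have h5 : (t₀ : ℝ) ^ (-κ) * D t₀ ≤ 1 * CD :=
        (mul_le_mul_of_nonneg_left ((le_abs_self _).trans (hD t₀ h1)) (by positivity)).trans
          (mul_le_mul_of_nonneg_right h4 hCD)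
      have h6 := ha t₀ h1
      have h7 := mul_le_mul_of_nonneg_left h5 hγ.le
      linarith
    | succ t ht ih =>
      obtain ⟨⟨h1, h2⟩, h3, h4⟩ := ht₀ t ht
      have hr := hrec t h3 h4
      have hsub := rpow_neg_sub_le hκ hκ1 h3
      have hmono : ((t + 1 : ℕ) : ℝ) ^ (-κ) ≤ (t : ℝ) ^ (-κ) :=
        Real.rpow_le_rpow_of_nonpos (by exact_mod_cast h3) (by push_cast; linarith) (by linarith)
      have hinv := rpow_neg_mul_inv_le hκ1 h3
      set x := (t : ℝ) ^ (-κ) with hx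
      set y := ((t + 1 : ℕ) : ℝ) ^ (-κ) with hy
      have hx0 : 0 ≤ x := by positivity
      have hxy : x - y ≤ x ^ 2 := by
        have h5 : x * (κ / t) ≤ x ^ 2 := by
          rw [sq]
          refine mul_le_mul_of_nonneg_left ?_ hx0
          rw [div_eq_mul_inv]
          have : (0 : ℝ) ≤ (t : ℝ)⁻¹ := by positivity
          nlinarith
        linarith
      have hD1 := abs_le.1 (hD t h3)
      have hD2 := abs_le.1 (hD (t + 1) (by omega))
      have e1 : (y - x) * D (t + 1) ≤ x ^ 2 * CD := by
        nlinarith [mul_nonneg (sub_nonneg.2 hmono) hCD, mul_nonneg (sub_nonneg.2 hmono) (by linarith : 0 ≤ CD + D (t + 1)), mul_le_mul_of_nonneg_right hxy hCD]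
      have e2 : x ^ 2 * D t ≤ x ^ 2 * CD := mul_le_mul_of_nonneg_left hD1.2 (sq_nonneg x)
      have e3 : a (t + 1) + 2 * (γ₀ * y) * D (t + 1) ≤
          (1 - ζ * (γ₀ * x)) * (a t + 2 * (γ₀ * x) * D t) + C' * x ^ 2 := by
        have e4 : 2 * γ₀ * ((y - x) * D (t + 1)) ≤ 2 * γ₀ * (x ^ 2 * CD) :=
          mul_le_mul_of_nonneg_left e1 (by positivity)
        have e5 : 2 * ζ * γ₀ ^ 2 * (x ^ 2 * D t) ≤ 2 * ζ * γ₀ ^ 2 * (x ^ 2 * CD) :=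
          mul_le_mul_of_nonneg_left e2 (by positivity)
        rw [hC']
        nlinarith
      have e6 : (1 - ζ * (γ₀ * x)) * (a t + 2 * (γ₀ * x) * D t) ≤
          (1 - ζ * (γ₀ * x)) * (K * x) :=
        mul_le_mul_of_nonneg_left ih (by linarith)
      have e7 : C' ≤ c * K := by
        have : C' / c ≤ K := le_max_left _ _
        rwa [div_le_iff₀ hc, mul_comm] at this
      have e8 : C' * x ^ 2 ≤ K * (ζ * γ₀ * x ^ 2 - x * (κ / t)) :=
        (mul_le_mul_of_nonneg_right e7 (sq_nonneg x)).trans (by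
          have := mul_le_mul_of_nonneg_left h1 hK0
          linarith)
      have e9 : K * (x * (1 - κ / t)) ≤ K * y := mul_le_mul_of_nonneg_left hsub hK0
      nlinarith
  intro t ht
  have h1 := key t ht
  have h2 := abs_le.1 (hD t (ht₀ t ht).2.1)
  have h3 : 0 ≤ (t : ℝ) ^ (-κ) := by positivity
  have h4 : γ₀ * (t : ℝ) ^ (-κ) * (-D t) ≤ γ₀ * (t : ℝ) ^ (-κ) * CD :=
    mul_le_mul_of_nonneg_left (by linarith) (by positivity)
  linarith

/-! ### The noise term -/

/-- A Markov kernel with stationary distribution `ν` and a weight `V`, whose second moments along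
the chain started at `w` are at most `M`, together with an operator `T` of norm at most `K` solving
the Poisson equation for functions dominated by `V`. -/
structure PoissonSetting {S : Type*} [MeasurableSpace S] (P : Kernel S S) [IsMarkovKernel P]
    (ν : Measure S) (V : S → ℝ) (K : ℝ) (T : (S → ℝ) → S → ℝ) (w : S) (M : ℝ) : Prop where
  measurable : Measurable V
  one_le : ∀ w, 1 ≤ V w
  integrable_stationary : Integrable V ν
  op_nonneg : 0 ≤ K
  op_measurable : ∀ f c, 0 ≤ c → Measurable f → (∀ w, |f w| ≤ c * V w) → Measurable (T f)
  op_bound : ∀ f c, 0 ≤ c → Measurable f → (∀ w, |f w| ≤ c * V w) → ∀ w, |T f w| ≤ K * c * V w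
  op_poisson : ∀ f c, 0 ≤ c → Measurable f → (∀ w, |f w| ≤ c * V w) → ∫ w, f w ∂ν = 0 →
    ∀ w, T f w = f w + ∫ w', T f w' ∂(P w)
  op_sub : ∀ f g c, 0 ≤ c → Measurable f → Measurable g → (∀ w, |f w| ≤ c * V w) →
    (∀ w, |g w| ≤ c * V w) → ∀ w, T (fun w => f w - g w) w = T f w - T g w
  moment_nonneg : 0 ≤ M
  moment_integrable : ∀ t, Integrable (fun W => V (W t) ^ 2) (chainLaw P w)
  moment_le : ∀ t, ∫ W, V (W t) ^ 2 ∂(chainLaw P w) ≤ M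

/-- The drift of the squared weight supplies the second moments, and the drift of the weight itself
supplies the Poisson operator. -/
lemma IsGeometricallyErgodicChain.exists_poissonSetting {E : Type*} [NormedAddCommGroup E]
    [MeasurableSpace E] [BorelSpace E] {𝒲 : Set E} {P : Kernel 𝒲 𝒲} [IsMarkovKernel P]
    {ν : Measure 𝒲} (h : IsGeometricallyErgodicChain P ν 2) (w : 𝒲) :
    ∃ K T M, PoissonSetting P ν lyapunovSqrt K T w M := by
  have := h.isProbabilityMeasure
  obtain ⟨C, ρ, b, b₁, N, φ, hC, hρ0, hρ1, hb, hd, hb₁, hφ, hmin⟩ := h.exists_drift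
  have hV1 := one_le_lyapunovSqrt (𝒲 := 𝒲)
  have hVm := measurable_lyapunovSqrt (𝒲 := 𝒲)
  have hd' : ∀ w, ∫⁻ w', ENNReal.ofReal (lyapunovSqrt w' ^ 2) ∂(P w) ≤
      ENNReal.ofReal (ρ * lyapunovSqrt w ^ 2 + b) := fun w => (hd w).trans
    (ENNReal.ofReal_le_ofReal (by
      have : C.indicator (fun _ => b) w ≤ b := Set.indicator_le_self' (fun _ _ => hb.le) w
      linarith))
  have hν2 : Integrable (fun w : 𝒲 => lyapunovSqrt w ^ 2) ν :=
    h.invariant.integrable_of_drift (hVm.pow_const 2) (fun _ => sq_nonneg _) hρ0 hρ1 hb.le hd'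
  have hν1 : Integrable (lyapunovSqrt (𝒲 := 𝒲)) ν :=
    hν2.mono' hVm.aestronglyMeasurable (ae_of_all _ fun w' => by
      have := hV1 w'
      rw [Real.norm_of_nonneg (by linarith)]; nlinarith)
  have hDM : DriftMinorization P ν lyapunovSqrt C (√ρ) (√b) b₁ N φ :=
    { invariant := h.invariant
      measurable := hVm
      one_le := hV1
      integrable_stationary := hν1
      integrable := fun w => (integral_lyapunovSqrt_le hρ0 hb w (hd w)).1
      measurableSet := hC
      rate_nonneg := Real.sqrt_nonneg _
      rate_lt_one := by rw [Real.sqrt_lt' one_pos]; simpa using hρ1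
      bound_pos := Real.sqrt_pos.2 hb
      drift := fun w => (integral_lyapunovSqrt_le hρ0 hb w (hd w)).2
      minor_pos := hb₁
      minorization := hmin }
  obtain ⟨K, hK, T, hT1, hT2⟩ := hDM.exists_poisson
  obtain ⟨M, hM0, hM⟩ := exists_moment_bound (hVm.pow_const 2) (fun _ => sq_nonneg _) hρ0 hρ1 hb.le
    hd' w
  exact ⟨K, T, M,
    { measurable := hVm
      one_le := hV1
      integrable_stationary := hν1
      op_nonneg := hK
      op_measurable := fun f c hc hf hfc => (hT1 f c hc hf hfc).1
      op_bound := fun f c hc hf hfc => (hT1 f c hc hf hfc).2.1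
      op_poisson := fun f c hc hf hfc => (hT1 f c hc hf hfc).2.2
      op_sub := hT2
      moment_nonneg := hM0
      moment_integrable := fun t => (hM t).1
      moment_le := fun t => (hM t).2 }⟩

namespace PoissonSetting

variable {S : Type*} [MeasurableSpace S] {P : Kernel S S} [IsMarkovKernel P]
  {ν : Measure S} {V : S → ℝ} {K M : ℝ} {T : (S → ℝ) → S → ℝ} {w : S}

lemma abs_integral_le (h : PoissonSetting P ν V K T w M) {t : ℕ} {g : (ℕ → S) → ℝ} {c : ℝ}
    (hc : 0 ≤ c) (hg : ∀ W, |g W| ≤ c * V (W t)) : |∫ W, g W ∂(chainLaw P w)| ≤ c * M := by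
  refine (norm_integral_le_of_norm_le (f := g) ((h.moment_integrable t).const_mul c)
    (ae_of_all _ fun W => (hg W).trans ?_)).trans ?_
  · have := h.one_le (W t)
    exact mul_le_mul_of_nonneg_left (by nlinarith) hc
  · rw [integral_const_mul]
    exact mul_le_mul_of_nonneg_left (h.moment_le t) hc

/-- The expected noise at a parameter process `θ`, where `f θ = u θ - P (u θ)`, telescopes up to an
error controlled by the increments of the process. -/
lemma integral_noise_le (h : PoissonSetting P ν V K T w M) {Θ : Type*} [MeasurableSpace Θ]
    {f u : Θ → S → ℝ} (hu : Measurable (fun p : Θ × S => u p.1 p.2)) {c a : ℝ} (hc : 0 ≤ c)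
    (ha : 0 ≤ a) {t : ℕ} {θ θ' : (ℕ → S) → Θ} (hθm : Measurable θ) (hθ'm : Measurable θ')
    (hθ : DependsOn θ (Set.Iic t)) (hub : ∀ W y, |u (θ W) y| ≤ c * V y)
    (hub' : ∀ W y, |u (θ' W) y| ≤ c * V y)
    (hinc : ∀ W y, |u (θ' W) y - u (θ W) y| ≤ a * V (W t) * V y)
    (hp : ∀ W y, u (θ W) y = f (θ W) y + ∫ y', u (θ W) y' ∂(P y)) :
    Integrable (fun W => f (θ W) (W t)) (chainLaw P w) ∧
      ∫ W, f (θ W) (W t) ∂(chainLaw P w) ≤ ∫ W, u (θ W) (W t) ∂(chainLaw P w) -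
        ∫ W, u (θ' W) (W (t + 1)) ∂(chainLaw P w) + a * M := by
  have hum : ∀ {η : (ℕ → S) → Θ} (s : ℕ), Measurable η → Measurable (fun W => u (η W) (W s)) :=
    fun s hη => hu.comp (hη.prodMk (measurable_pi_apply s))
  have hui : ∀ {η : (ℕ → S) → Θ} (s : ℕ), Measurable η → (∀ W y, |u (η W) y| ≤ c * V y) →
      Integrable (fun W => u (η W) (W s)) (chainLaw P w) := fun s hη hb =>
    ((h.moment_integrable s).const_mul c).mono' (hum s hη).aestronglyMeasurable
      (ae_of_all _ fun W => (hb W _).trans (by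
        have := h.one_le (W s)
        exact mul_le_mul_of_nonneg_left (by nlinarith) hc))
  -- As `θ` depends only on the history up to `t`, the term `P (u θ)` at `W t` has the same mean as
  -- `u θ` at `W (t + 1)`.
  obtain ⟨h1, h2⟩ := integral_chainLaw_succ w hθm hθ (g := fun p => u p.1 p.2) hu
    (hui (t + 1) hθm hub)
  have hf : (fun W => f (θ W) (W t)) =
      fun W => u (θ W) (W t) - ∫ y, u (θ W) y ∂(P (W t)) := by
    funext W
    have := hp W (W t)
    linarith
  rw [hf]
  refine ⟨(hui t hθm hub).sub h2, ?_⟩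
  rw [integral_sub (hui t hθm hub) h2, ← h1]
  have h3 : ∫ W, (u (θ' W) (W (t + 1)) - u (θ W) (W (t + 1))) ∂(chainLaw P w) ≤ a * M := by
    have hi : Integrable (fun W => a * ((V (W t) ^ 2 + V (W (t + 1)) ^ 2) / 2)) (chainLaw P w) :=
      (((h.moment_integrable t).add (h.moment_integrable (t + 1))).div_const 2).const_mul a
    refine (integral_mono ((hui _ hθ'm hub').sub (hui _ hθm hub)) hi fun W => ?_).trans ?_
    · refine ((le_abs_self _).trans (hinc W _)).trans ?_
      rw [mul_assoc]
      -- The product of the weights at consecutive times is at most the mean of their squares; this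
      -- is where second moments enter.
      exact mul_le_mul_of_nonneg_left (by nlinarith [sq_nonneg (V (W t) - V (W (t + 1)))]) ha
    · rw [integral_const_mul, integral_div,
        integral_add (h.moment_integrable t) (h.moment_integrable (t + 1))]
      refine mul_le_mul_of_nonneg_left ?_ ha
      linarith [h.moment_le t, h.moment_le (t + 1)]
  rw [integral_sub (hui _ hθ'm hub') (hui _ hθm hub)] at h3
  linarith

end PoissonSetting

/-! ### The averaged field and the noise function -/

/-- A random field which is Lipschitz and bounded on balls of radius `B`, with coefficients
proportional to the weight `V`. -/
structure LipschitzGrowth {S : Type*} [MeasurableSpace S] {m n : ℕ}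
    (G : S → EuclideanSpace ℝ (Fin m) → EuclideanSpace ℝ (Fin n) → EuclideanSpace ℝ (Fin m))
    (V : S → ℝ) (B c : ℝ) : Prop where
  measurable : Measurable
    (fun p : S × EuclideanSpace ℝ (Fin m) × EuclideanSpace ℝ (Fin n) => G p.1 p.2.1 p.2.2)
  nonneg : 0 ≤ c
  lipschitz : ∀ w lam lam' xi xi', ‖lam‖ ≤ B → ‖lam'‖ ≤ B → ‖xi‖ ≤ B → ‖xi'‖ ≤ B →
    ‖G w lam xi - G w lam' xi'‖ ≤ c * V w * (‖lam - lam'‖ + ‖xi - xi'‖)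
  growth : ∀ w lam xi, ‖lam‖ ≤ B → ‖xi‖ ≤ B → ‖G w lam xi‖ ≤ c * V w

/-- The component of the centred field in the direction of the error. -/
noncomputable def noiseFun {S : Type*} [MeasurableSpace S] {m n : ℕ} (ν : Measure S)
    (G : S → EuclideanSpace ℝ (Fin m) → EuclideanSpace ℝ (Fin n) → EuclideanSpace ℝ (Fin m))
    (lamStar : EuclideanSpace ℝ (Fin m))
    (θ : EuclideanSpace ℝ (Fin m) × EuclideanSpace ℝ (Fin n)) (w : S) : ℝ :=
  inner ℝ (θ.1 - lamStar) (G w θ.1 θ.2 - ∫ w', G w' θ.1 θ.2 ∂ν)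

namespace LipschitzGrowth

variable {S : Type*} [MeasurableSpace S] {m n : ℕ}
  {G : S → EuclideanSpace ℝ (Fin m) → EuclideanSpace ℝ (Fin n) → EuclideanSpace ℝ (Fin m)}
  {V : S → ℝ} {B c : ℝ} {ν : Measure S}

lemma measurable_apply (hG : LipschitzGrowth G V B c) (lam : EuclideanSpace ℝ (Fin m))
    (xi : EuclideanSpace ℝ (Fin n)) : Measurable (fun w => G w lam xi) :=
  hG.measurable.comp (measurable_id.prodMk (measurable_const (a := (lam, xi))))

lemma integrable (hG : LipschitzGrowth G V B c) (hV : Integrable V ν)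
    {lam : EuclideanSpace ℝ (Fin m)} {xi : EuclideanSpace ℝ (Fin n)} (hlam : ‖lam‖ ≤ B)
    (hxi : ‖xi‖ ≤ B) : Integrable (fun w => G w lam xi) ν :=
  (hV.const_mul c).mono' (hG.measurable_apply lam xi).aestronglyMeasurable
    (ae_of_all _ fun w => hG.growth w lam xi hlam hxi)

lemma norm_mean_le (hG : LipschitzGrowth G V B c) (hV : Integrable V ν)
    {lam : EuclideanSpace ℝ (Fin m)} {xi : EuclideanSpace ℝ (Fin n)} (hlam : ‖lam‖ ≤ B)
    (hxi : ‖xi‖ ≤ B) : ‖∫ w, G w lam xi ∂ν‖ ≤ c * ∫ w, V w ∂ν := by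
  rw [← integral_const_mul]
  exact norm_integral_le_of_norm_le (hV.const_mul c)
    (ae_of_all _ fun w => hG.growth w lam xi hlam hxi)

lemma norm_mean_sub_le (hG : LipschitzGrowth G V B c) (hV : Integrable V ν)
    {lam lam' : EuclideanSpace ℝ (Fin m)} {xi xi' : EuclideanSpace ℝ (Fin n)} (hlam : ‖lam‖ ≤ B)
    (hlam' : ‖lam'‖ ≤ B) (hxi : ‖xi‖ ≤ B) (hxi' : ‖xi'‖ ≤ B) :
    ‖∫ w, G w lam xi ∂ν - ∫ w, G w lam' xi' ∂ν‖ ≤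
      c * (∫ w, V w ∂ν) * (‖lam - lam'‖ + ‖xi - xi'‖) := by
  rw [← integral_sub (hG.integrable hV hlam hxi) (hG.integrable hV hlam' hxi'),
    ← integral_const_mul, ← integral_mul_const]
  exact norm_integral_le_of_norm_le ((hV.const_mul c).mul_const _)
    (ae_of_all _ fun w => hG.lipschitz w lam lam' xi xi' hlam hlam' hxi hxi')

lemma measurable_noiseFun (hG : LipschitzGrowth G V B c) (lamStar : EuclideanSpace ℝ (Fin m))
    (θ : EuclideanSpace ℝ (Fin m) × EuclideanSpace ℝ (Fin n)) :
    Measurable (noiseFun ν G lamStar θ) :=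
  measurable_const.inner ((hG.measurable_apply θ.1 θ.2).sub_const _)

lemma integral_noiseFun [IsProbabilityMeasure ν] (hG : LipschitzGrowth G V B c)
    (hV : Integrable V ν) (lamStar : EuclideanSpace ℝ (Fin m))
    {θ : EuclideanSpace ℝ (Fin m) × EuclideanSpace ℝ (Fin n)} (h1 : ‖θ.1‖ ≤ B) (h2 : ‖θ.2‖ ≤ B) :
    ∫ w, noiseFun ν G lamStar θ w ∂ν = 0 := by
  have hi := hG.integrable hV h1 h2
  have hi2 : Integrable (fun w => G w θ.1 θ.2 - ∫ w', G w' θ.1 θ.2 ∂ν) ν :=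
    hi.sub (integrable_const _)
  unfold noiseFun
  rw [integral_inner hi2, integral_sub hi (integrable_const _),
    integral_const, probReal_univ, one_smul, sub_self, inner_zero_right]

lemma norm_centred_le (hG : LipschitzGrowth G V B c) (hV : Integrable V ν) (hV1 : ∀ w, 1 ≤ V w)
    {lam : EuclideanSpace ℝ (Fin m)} {xi : EuclideanSpace ℝ (Fin n)} (hlam : ‖lam‖ ≤ B)
    (hxi : ‖xi‖ ≤ B) (w : S) :
    ‖G w lam xi - ∫ w', G w' lam xi ∂ν‖ ≤ c * (1 + ∫ w, V w ∂ν) * V w := by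
  have h1 := hG.growth w lam xi hlam hxi
  have h2 := hG.norm_mean_le hV hlam hxi
  have h3 : 0 ≤ ∫ w, V w ∂ν := integral_nonneg fun w => zero_le_one.trans (hV1 w)
  refine (norm_sub_le _ _).trans ?_
  nlinarith [mul_nonneg (mul_nonneg hG.nonneg h3) (sub_nonneg.2 (hV1 w))]

lemma abs_noiseFun_le (hG : LipschitzGrowth G V B c) (hV : Integrable V ν) (hV1 : ∀ w, 1 ≤ V w)
    {lamStar : EuclideanSpace ℝ (Fin m)} (hstar : ‖lamStar‖ ≤ B)
    {θ : EuclideanSpace ℝ (Fin m) × EuclideanSpace ℝ (Fin n)} (h1 : ‖θ.1‖ ≤ B) (h2 : ‖θ.2‖ ≤ B)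
    (w : S) : |noiseFun ν G lamStar θ w| ≤ 2 * B * (c * (1 + ∫ w, V w ∂ν)) * V w := by
  refine (abs_real_inner_le_norm _ _).trans ?_
  have h3 : ‖θ.1 - lamStar‖ ≤ 2 * B := (norm_sub_le _ _).trans (by linarith)
  rw [mul_assoc]
  exact mul_le_mul h3 (hG.norm_centred_le hV hV1 h1 h2 w) (norm_nonneg _)
    ((norm_nonneg _).trans h3)

lemma abs_noiseFun_sub_le (hG : LipschitzGrowth G V B c) (hV : Integrable V ν)
    (hV1 : ∀ w, 1 ≤ V w) {lamStar : EuclideanSpace ℝ (Fin m)} (hstar : ‖lamStar‖ ≤ B)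
    {θ θ' : EuclideanSpace ℝ (Fin m) × EuclideanSpace ℝ (Fin n)} (h1 : ‖θ.1‖ ≤ B)
    (h2 : ‖θ.2‖ ≤ B) (h1' : ‖θ'.1‖ ≤ B) (h2' : ‖θ'.2‖ ≤ B) (w : S) :
    |noiseFun ν G lamStar θ w - noiseFun ν G lamStar θ' w| ≤
      (1 + 2 * B) * (c * (1 + ∫ w, V w ∂ν)) * (‖θ.1 - θ'.1‖ + ‖θ.2 - θ'.2‖) * V w := by
  set g := G w θ.1 θ.2 - ∫ w', G w' θ.1 θ.2 ∂ν with hg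
  set g' := G w θ'.1 θ'.2 - ∫ w', G w' θ'.1 θ'.2 ∂ν with hg'
  have hB : 0 ≤ B := (norm_nonneg _).trans hstar
  have h0 : 0 ≤ ∫ w, V w ∂ν := integral_nonneg fun w => zero_le_one.trans (hV1 w)
  have hc := hG.nonneg
  set D := ‖θ.1 - θ'.1‖ + ‖θ.2 - θ'.2‖ with hD
  have hD0 : 0 ≤ D := by positivity
  -- Both factors of the inner product move with `θ`; the change is split into one term for each.
  have e1 : noiseFun ν G lamStar θ w - noiseFun ν G lamStar θ' w =
      inner ℝ (θ.1 - θ'.1) g + inner ℝ (θ'.1 - lamStar) (g - g') := by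
    simp only [noiseFun, ← hg, ← hg', inner_sub_left, inner_sub_right]
    ring
  have e2 : |inner ℝ (θ.1 - θ'.1) g| ≤ D * (c * (1 + ∫ w, V w ∂ν) * V w) :=
    (abs_real_inner_le_norm _ _).trans (mul_le_mul (le_add_of_nonneg_right (norm_nonneg _))
      (hG.norm_centred_le hV hV1 h1 h2 w) (norm_nonneg _) hD0)
  have e3 : ‖g - g'‖ ≤ c * (1 + ∫ w, V w ∂ν) * V w * D := by
    have h3 := hG.lipschitz w θ.1 θ'.1 θ.2 θ'.2 h1 h1' h2 h2'
    have h4 := hG.norm_mean_sub_le hV h1 h1' h2 h2'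
    have h5 : g - g' = (G w θ.1 θ.2 - G w θ'.1 θ'.2) -
        (∫ w', G w' θ.1 θ.2 ∂ν - ∫ w', G w' θ'.1 θ'.2 ∂ν) := by rw [hg, hg']; abel
    rw [h5]
    refine (norm_sub_le _ _).trans ?_
    nlinarith [mul_nonneg (mul_nonneg (mul_nonneg hc h0) hD0) (sub_nonneg.2 (hV1 w))]
  have e4 : ‖θ'.1 - lamStar‖ ≤ 2 * B := (norm_sub_le _ _).trans (by linarith)
  have e5 : |inner ℝ (θ'.1 - lamStar) (g - g')| ≤
      2 * B * (c * (1 + ∫ w, V w ∂ν) * V w * D) :=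
    (abs_real_inner_le_norm _ _).trans (mul_le_mul e4 e3 (norm_nonneg _) (by positivity))
  rw [e1]
  refine (abs_add_le _ _).trans ?_
  nlinarith

end LipschitzGrowth

/-! ### The one-step inequality -/

/-- One step of the projected iteration, along any trajectory. -/
lemma norm_sq_step_le {S : Type*} [MeasurableSpace S] {m n : ℕ}
    {G : S → EuclideanSpace ℝ (Fin m) → EuclideanSpace ℝ (Fin n) → EuclideanSpace ℝ (Fin m)}
    {V : S → ℝ} {B c : ℝ} {ν : Measure S} (hG : LipschitzGrowth G V B c) (hV : Integrable V ν)
    (hB : 0 < B) {lamStar : EuclideanSpace ℝ (Fin m)}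
    {xiStar : EuclideanSpace ℝ (Fin n)} (hlamStar : ‖lamStar‖ ≤ B) (hxiStar : ‖xiStar‖ ≤ B)
    {ζ : ℝ} (hζ : 0 < ζ)
    (hmono : ∀ lam, inner ℝ (lam - lamStar) (∫ w, G w lam xiStar ∂ν) ≤ -ζ * ‖lam - lamStar‖ ^ 2)
    {lam : EuclideanSpace ℝ (Fin m)} {xi : EuclideanSpace ℝ (Fin n)} (hlam : ‖lam‖ ≤ B)
    (hxi : ‖xi‖ ≤ B) {γ : ℝ} (hγ : 0 ≤ γ) (w : S) :
    ‖ballProj B (lam + γ • G w lam xi) - lamStar‖ ^ 2 ≤ (1 - ζ * γ) * ‖lam - lamStar‖ ^ 2 +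
      γ * ((c * ∫ w, V w ∂ν) ^ 2 / ζ) * ‖xi - xiStar‖ ^ 2 +
      2 * γ * noiseFun ν G lamStar (lam, xi) w + γ ^ 2 * (c ^ 2 * V w ^ 2) := by
  set x := lam - lamStar with hx
  set L := c * ∫ w, V w ∂ν with hL
  have h1 : ‖ballProj B (lam + γ • G w lam xi) - lamStar‖ ^ 2 ≤ ‖x + γ • G w lam xi‖ ^ 2 := by
    have h2 := norm_ballProj_sub_le hB (lam + γ • G w lam xi) hlamStar
    have h3 : lam + γ • G w lam xi - lamStar = x + γ • G w lam xi := by rw [hx]; abel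
    rw [h3] at h2
    exact pow_le_pow_left₀ (norm_nonneg _) h2 2
  have h2 : ‖x + γ • G w lam xi‖ ^ 2 =
      ‖x‖ ^ 2 + 2 * γ * inner ℝ x (G w lam xi) + γ ^ 2 * ‖G w lam xi‖ ^ 2 := by
    rw [norm_add_sq_real, inner_smul_right, norm_smul, mul_pow, Real.norm_eq_abs, sq_abs]
    ring
  have h3 : ‖G w lam xi‖ ^ 2 ≤ c ^ 2 * V w ^ 2 := by
    rw [← mul_pow]
    exact pow_le_pow_left₀ (norm_nonneg _) (hG.growth w lam xi hlam hxi) 2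
  -- The field splits into noise, the mean field at `xiStar`, and the error in the mean field caused
  -- by `xi`.
  have h4 : inner ℝ x (G w lam xi) = noiseFun ν G lamStar (lam, xi) w +
      inner ℝ x (∫ w, G w lam xiStar ∂ν) +
      inner ℝ x (∫ w, G w lam xi ∂ν - ∫ w, G w lam xiStar ∂ν) := by
    simp only [noiseFun, inner_sub_right, ← hx]
    ring
  have h5 := hmono lam
  -- Young's inequality spends half of the monotonicity constant, so the rate `2 ζ γ` drops to `ζ
  -- γ`.
  have h6 : inner ℝ x (∫ w, G w lam xi ∂ν - ∫ w, G w lam xiStar ∂ν) ≤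
      ζ / 2 * ‖x‖ ^ 2 + L ^ 2 / (2 * ζ) * ‖xi - xiStar‖ ^ 2 := by
    have h7 := hG.norm_mean_sub_le hV hlam hlam hxi hxiStar
    rw [sub_self, norm_zero, zero_add, ← hL] at h7
    refine (real_inner_le_norm _ _).trans
      ((mul_le_mul_of_nonneg_left h7 (norm_nonneg x)).trans ?_)
    have h8 : ζ / 2 * ‖x‖ ^ 2 + L ^ 2 / (2 * ζ) * ‖xi - xiStar‖ ^ 2 -
        ‖x‖ * (L * ‖xi - xiStar‖) = (ζ * ‖x‖ - L * ‖xi - xiStar‖) ^ 2 / (2 * ζ) := by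
      field_simp; ring
    have h9 : 0 ≤ (ζ * ‖x‖ - L * ‖xi - xiStar‖) ^ 2 / (2 * ζ) := by positivity
    linarith
  have h7 : 2 * γ * inner ℝ x (G w lam xi) ≤ 2 * γ * (noiseFun ν G lamStar (lam, xi) w +
      -ζ * ‖x‖ ^ 2 + (ζ / 2 * ‖x‖ ^ 2 + L ^ 2 / (2 * ζ) * ‖xi - xiStar‖ ^ 2)) := by
    refine mul_le_mul_of_nonneg_left ?_ (by positivity)
    linarith
  have h8 : 2 * γ * (L ^ 2 / (2 * ζ) * ‖xi - xiStar‖ ^ 2) = γ * (L ^ 2 / ζ) * ‖xi - xiStar‖ ^ 2 := by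
    field_simp
  have h9 : γ ^ 2 * ‖G w lam xi‖ ^ 2 ≤ γ ^ 2 * (c ^ 2 * V w ^ 2) :=
    mul_le_mul_of_nonneg_left h3 (sq_nonneg γ)
  rw [h2] at h1
  linarith

/-! ### The convergence rate of a projected iteration -/

section

variable {S : Type*} [MeasurableSpace S] {P : Kernel S S} [IsMarkovKernel P]
  {ν : Measure S} {V : S → ℝ} {K M : ℝ} {T : (S → ℝ) → S → ℝ} {w : S} {m n : ℕ}
  {G : S → EuclideanSpace ℝ (Fin m) → EuclideanSpace ℝ (Fin n) → EuclideanSpace ℝ (Fin m)}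
  {B c : ℝ} {lamStar : EuclideanSpace ℝ (Fin m)}

/-- The noise function at the projected parameter. -/
noncomputable def projNoise (ν : Measure S)
    (G : S → EuclideanSpace ℝ (Fin m) → EuclideanSpace ℝ (Fin n) → EuclideanSpace ℝ (Fin m))
    (lamStar : EuclideanSpace ℝ (Fin m)) (B : ℝ)
    (θ : EuclideanSpace ℝ (Fin m) × EuclideanSpace ℝ (Fin n)) : S → ℝ :=
  noiseFun ν G lamStar (ballProj B θ.1, ballProj B θ.2)

lemma LipschitzGrowth.measurable_projNoise (hG : LipschitzGrowth G V B c)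
    (θ : EuclideanSpace ℝ (Fin m) × EuclideanSpace ℝ (Fin n)) :
    Measurable (projNoise ν G lamStar B θ) :=
  hG.measurable_noiseFun _ _

namespace PoissonSetting

lemma abs_projNoise_le (h : PoissonSetting P ν V K T w M) (hG : LipschitzGrowth G V B c)
    (hB : 0 < B) (hstar : ‖lamStar‖ ≤ B)
    (θ : EuclideanSpace ℝ (Fin m) × EuclideanSpace ℝ (Fin n)) (y : S) :
    |projNoise ν G lamStar B θ y| ≤ 2 * B * (c * (1 + ∫ w, V w ∂ν)) * V y :=
  hG.abs_noiseFun_le (θ := (ballProj B θ.1, ballProj B θ.2)) h.integrable_stationary h.one_le hstar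
    (norm_ballProj_le hB _) (norm_ballProj_le hB _) y

lemma integral_weight_nonneg (h : PoissonSetting P ν V K T w M) : 0 ≤ ∫ w, V w ∂ν :=
  integral_nonneg fun w => zero_le_one.trans (h.one_le w)

lemma abs_op_projNoise_le (h : PoissonSetting P ν V K T w M) (hG : LipschitzGrowth G V B c)
    (hB : 0 < B) (hstar : ‖lamStar‖ ≤ B)
    (θ : EuclideanSpace ℝ (Fin m) × EuclideanSpace ℝ (Fin n)) (y : S) :
    |T (projNoise ν G lamStar B θ) y| ≤ K * (2 * B * (c * (1 + ∫ w, V w ∂ν))) * V y :=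
  h.op_bound _ _ (by have := h.integral_weight_nonneg; have := hG.nonneg; positivity)
    (hG.measurable_projNoise _) (h.abs_projNoise_le hG hB hstar θ) y

/-- Linearity of `T` reduces this to the norm bound on a difference of noise functions, so Poisson
solutions inherit the Lipschitz dependence on the parameter. -/
lemma abs_op_projNoise_sub_le (h : PoissonSetting P ν V K T w M) (hG : LipschitzGrowth G V B c)
    (hB : 0 < B) (hstar : ‖lamStar‖ ≤ B)
    (θ θ' : EuclideanSpace ℝ (Fin m) × EuclideanSpace ℝ (Fin n)) (y : S) :
    |T (projNoise ν G lamStar B θ) y - T (projNoise ν G lamStar B θ') y| ≤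
      K * ((1 + 2 * B) * (c * (1 + ∫ w, V w ∂ν)) * (‖θ.1 - θ'.1‖ + ‖θ.2 - θ'.2‖)) * V y := by
  have h0 := h.integral_weight_nonneg
  have hc := hG.nonneg
  rw [← h.op_sub _ _ (2 * B * (c * (1 + ∫ w, V w ∂ν))) (by positivity)
    (hG.measurable_projNoise _) (hG.measurable_projNoise _) (h.abs_projNoise_le hG hB hstar θ)
    (h.abs_projNoise_le hG hB hstar θ')]
  refine h.op_bound _ _ (by positivity)
    ((hG.measurable_projNoise _).sub (hG.measurable_projNoise _)) (fun y => ?_) y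
  refine (hG.abs_noiseFun_sub_le (θ := (ballProj B θ.1, ballProj B θ.2))
    (θ' := (ballProj B θ'.1, ballProj B θ'.2)) h.integrable_stationary h.one_le hstar
    (norm_ballProj_le hB _) (norm_ballProj_le hB _) (norm_ballProj_le hB _)
    (norm_ballProj_le hB _) y).trans ?_
  have hV0 : 0 ≤ V y := zero_le_one.trans (h.one_le y)
  have h1 := norm_ballProj_sub_ballProj_le hB θ.1 θ'.1
  have h2 := norm_ballProj_sub_ballProj_le hB θ.2 θ'.2
  gcongr

/-- `T` is an abstract operator, so joint measurability is obtained as for Carathéodory functions: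
continuity in `θ`, measurability in `y`. Projecting the parameter makes the Lipschitz bound hold on
the whole space. -/
lemma measurable_op_projNoise (h : PoissonSetting P ν V K T w M) (hG : LipschitzGrowth G V B c)
    (hB : 0 < B) (hstar : ‖lamStar‖ ≤ B) :
    Measurable (fun p : (EuclideanSpace ℝ (Fin m) × EuclideanSpace ℝ (Fin n)) × S =>
      T (projNoise ν G lamStar B p.1) p.2) := by
  have h0 := h.integral_weight_nonneg
  have hc := hG.nonneg
  refine (stronglyMeasurable_uncurry_of_continuous_of_stronglyMeasurable
    (u := fun θ => T (projNoise ν G lamStar B θ)) (fun y => ?_) (fun θ => ?_)).measurable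
  · refine (LipschitzWith.of_dist_le'
      (K := K * ((1 + 2 * B) * (c * (1 + ∫ w, V w ∂ν)) * 2) * V y) fun θ θ' => ?_).continuous
    refine (h.abs_op_projNoise_sub_le hG hB hstar θ θ' y).trans ?_
    have hV0 : 0 ≤ V y := zero_le_one.trans (h.one_le y)
    have hK := h.op_nonneg
    have h1 : ‖θ.1 - θ'.1‖ ≤ dist θ θ' := by
      rw [← dist_eq_norm, Prod.dist_eq]; exact le_max_left _ _
    have h2 : ‖θ.2 - θ'.2‖ ≤ dist θ θ' := by
      rw [← dist_eq_norm, Prod.dist_eq]; exact le_max_right _ _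
    calc _ ≤ K * ((1 + 2 * B) * (c * (1 + ∫ w, V w ∂ν)) * (dist θ θ' + dist θ θ')) * V y := by
          gcongr
      _ = _ := by ring
  · exact (h.op_measurable _ _ (by positivity) (hG.measurable_projNoise _)
      (h.abs_projNoise_le hG hB hstar θ)).stronglyMeasurable

/-- A projected iteration, driven by the chain and by an auxiliary process which moves at most at
the same speed and converges in mean square at the rate of the step sizes, converges in mean square
at that rate. The constants do not depend on the processes. -/
theorem exists_rate_bound [IsProbabilityMeasure ν] (h : PoissonSetting P ν V K T w M)
    (hG : LipschitzGrowth G V B c) (hB : 0 < B) (hlamStar : ‖lamStar‖ ≤ B)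
    {xiStar : EuclideanSpace ℝ (Fin n)} (hxiStar : ‖xiStar‖ ≤ B) {ζ : ℝ} (hζ : 0 < ζ)
    (hmono : ∀ lam, inner ℝ (lam - lamStar) (∫ w, G w lam xiStar ∂ν) ≤ -ζ * ‖lam - lamStar‖ ^ 2)
    {κ γ₀ : ℝ} (hκ : 0 < κ) (hκ1 : κ ≤ 1) (hγ₀ : 0 < γ₀) (hone : κ = 1 → 1 < ζ * γ₀)
    {γ : ℕ → ℝ} (hγ : ∀ t : ℕ, 1 ≤ t → γ t = γ₀ * (t : ℝ) ^ (-κ)) (t₁ : ℕ) {C₁ K₁ : ℝ}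
    (hC₁ : 0 ≤ C₁) (hK₁ : 0 ≤ K₁) :
    ∃ (K' : ℝ) (t₀ : ℕ), 0 ≤ K' ∧ ∀ (lam : ℕ → (ℕ → S) → EuclideanSpace ℝ (Fin m))
      (xi : ℕ → (ℕ → S) → EuclideanSpace ℝ (Fin n)),
      (∀ t, Measurable (lam t)) → (∀ t, Measurable (xi t)) →
      (∀ t, DependsOn (lam t) (Set.Iic t)) → (∀ t, DependsOn (xi t) (Set.Iic t)) →
      (∀ t, 1 ≤ t → ∀ W, ‖lam t W‖ ≤ B) → (∀ t, 1 ≤ t → ∀ W, ‖xi t W‖ ≤ B) →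
      (∀ t, 1 ≤ t → ∀ W, lam (t + 1) W =
        ballProj B (lam t W + γ t • G (W t) (lam t W) (xi t W))) →
      (∀ t, 1 ≤ t → ∀ W, ‖xi (t + 1) W - xi t W‖ ≤ C₁ * γ t * V (W t)) →
      (∀ t, t₁ ≤ t → ∫ W, ‖xi t W - xiStar‖ ^ 2 ∂(chainLaw P w) ≤ K₁ * (t : ℝ) ^ (-κ)) →
      ∀ t, t₀ ≤ t → ∫ W, ‖lam t W - lamStar‖ ^ 2 ∂(chainLaw P w) ≤ K' * (t : ℝ) ^ (-κ) := by
  have hc := hG.nonneg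
  have hm0 := h.integral_weight_nonneg
  have hK := h.op_nonneg
  have hM := h.moment_nonneg
  set m₀ := ∫ w, V w ∂ν with hm₀
  set cu := K * (2 * B * (c * (1 + m₀))) with hcu
  set cl := (1 + 2 * B) * (c * (1 + m₀)) with hcl
  have hcu0 : 0 ≤ cu := by positivity
  have hcl0 : 0 ≤ cl := by positivity
  -- The three summands come from the auxiliary error, the movement of the parameters in the Poisson
  -- solution, and the squared step.
  set C := γ₀ * ((c * m₀) ^ 2 / ζ) * K₁ + 2 * γ₀ ^ 2 * (K * (cl * (c + C₁)) * M) +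
    γ₀ ^ 2 * (c ^ 2 * M) with hC
  obtain ⟨K', t₀, hK', -, hrec⟩ := exists_recursion_bound hκ hκ1 hγ₀ hζ hone t₁
    (A₀ := (2 * B) ^ 2) (CD := cu * M) (C := C) (by positivity) (by positivity)
  refine ⟨K', t₀, hK', fun lam xi hlm hxm hld hxd hlB hxB hstep hinc hxi t ht => ?_⟩
  let u : EuclideanSpace ℝ (Fin m) × EuclideanSpace ℝ (Fin n) → S → ℝ :=
    fun θ => T (projNoise ν G lamStar B θ)
  let θ : ℕ → (ℕ → S) → EuclideanSpace ℝ (Fin m) × EuclideanSpace ℝ (Fin n) :=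
    fun t W => (lam t W, xi t W)
  have hθm : ∀ t, Measurable (θ t) := fun t => (hlm t).prodMk (hxm t)
  have hθd : ∀ t, DependsOn (θ t) (Set.Iic t) := fun t W W' hW =>
    Prod.ext (hld t hW) (hxd t hW)
  have hlb : ∀ t, 1 ≤ t → ∀ W, ‖lam t W - lamStar‖ ^ 2 ≤ (2 * B) ^ 2 := fun t ht W =>
    pow_le_pow_left₀ (norm_nonneg _) ((norm_sub_le _ _).trans (by linarith [hlB t ht W])) 2
  have hxb : ∀ t, 1 ≤ t → ∀ W, ‖xi t W - xiStar‖ ^ 2 ≤ (2 * B) ^ 2 := fun t ht W =>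
    pow_le_pow_left₀ (norm_nonneg _) ((norm_sub_le _ _).trans (by linarith [hxB t ht W])) 2
  have hli : ∀ t, 1 ≤ t → Integrable (fun W => ‖lam t W - lamStar‖ ^ 2) (chainLaw P w) :=
    fun t ht => Integrable.of_bound (((hlm t).sub_const _).norm.pow_const 2).aestronglyMeasurable
      ((2 * B) ^ 2) (ae_of_all _ fun W => by
        rw [Real.norm_of_nonneg (sq_nonneg _)]; exact hlb t ht W)
  have hxint : ∀ t, 1 ≤ t → Integrable (fun W => ‖xi t W - xiStar‖ ^ 2) (chainLaw P w) :=
    fun t ht => Integrable.of_bound (((hxm t).sub_const _).norm.pow_const 2).aestronglyMeasurable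
      ((2 * B) ^ 2) (ae_of_all _ fun W => by
        rw [Real.norm_of_nonneg (sq_nonneg _)]; exact hxb t ht W)
  refine hrec (fun t => ∫ W, ‖lam t W - lamStar‖ ^ 2 ∂(chainLaw P w))
    (fun t => ∫ W, u (θ t W) (W t) ∂(chainLaw P w)) (fun t ht => ?_) (fun t ht => ?_)
    (fun t ht ht₁ => ?_) t ht
  · have := integral_mono (hli t ht) (integrable_const ((2 * B) ^ 2)) (hlb t ht)
    simpa using this
  · exact h.abs_integral_le hcu0 fun W => h.abs_op_projNoise_le hG hB hlamStar _ _
  · have ht0 : (0 : ℝ) < t := by exact_mod_cast ht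
    have hx0 : 0 ≤ (t : ℝ) ^ (-κ) := by positivity
    have hγ0 : 0 ≤ γ t := by rw [hγ t ht]; positivity
    have hlinc : ∀ W, ‖lam (t + 1) W - lam t W‖ ≤ c * γ t * V (W t) := fun W => by
      rw [hstep t ht W]
      refine (norm_ballProj_sub_le hB _ (hlB t ht W)).trans ?_
      rw [add_sub_cancel_left, norm_smul, Real.norm_of_nonneg hγ0]
      have := mul_le_mul_of_nonneg_left (hG.growth (W t) _ _ (hlB t ht W) (hxB t ht W)) hγ0
      linarith
    obtain ⟨hfi, hfle⟩ := h.integral_noise_le (f := projNoise ν G lamStar B) (u := u) (c := cu)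
      (a := K * (cl * (c + C₁)) * γ t) (t := t) (θ := θ t) (θ' := θ (t + 1))
      (h.measurable_op_projNoise hG hB hlamStar) hcu0 (by positivity) (hθm t) (hθm (t + 1)) (hθd t)
      (fun W y => h.abs_op_projNoise_le hG hB hlamStar _ _)
      (fun W y => h.abs_op_projNoise_le hG hB hlamStar _ _)
      (fun W y => by
        refine (h.abs_op_projNoise_sub_le hG hB hlamStar (θ (t + 1) W) (θ t W) y).trans ?_
        have hV0 : 0 ≤ V y := zero_le_one.trans (h.one_le y)
        have h1 : ‖(θ (t + 1) W).1 - (θ t W).1‖ + ‖(θ (t + 1) W).2 - (θ t W).2‖ ≤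
            (c + C₁) * γ t * V (W t) := by
          have := hlinc W
          have := hinc t ht W
          simp only [θ]
          linarith
        calc _ ≤ K * (cl * ((c + C₁) * γ t * V (W t))) * V y := by rw [hcl]; gcongr
          _ = _ := by ring)
      (fun W y => h.op_poisson _ (2 * B * (c * (1 + m₀))) (by positivity)
        (hG.measurable_projNoise _) (h.abs_projNoise_le hG hB hlamStar _)
        (hG.integral_noiseFun h.integrable_stationary _ (norm_ballProj_le hB _)
          (norm_ballProj_le hB _)) y)
    -- From time `1` on the iterates lie in the ball, so projecting them changes nothing. Starting
    -- there also keeps the constants free of the initial points.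
    have hpath : ∀ W, ‖lam (t + 1) W - lamStar‖ ^ 2 ≤ (1 - ζ * γ t) * ‖lam t W - lamStar‖ ^ 2 +
        γ t * ((c * m₀) ^ 2 / ζ) * ‖xi t W - xiStar‖ ^ 2 +
        2 * γ t * projNoise ν G lamStar B (θ t W) (W t) + γ t ^ 2 * c ^ 2 * V (W t) ^ 2 := fun W => by
      have h1 := norm_sq_step_le hG h.integrable_stationary hB hlamStar hxiStar hζ hmono
        (hlB t ht W) (hxB t ht W) hγ0 (W t)
      rw [← hstep t ht W] at h1
      simp only [θ, projNoise, ballProj_of_norm_le (hlB t ht W), ballProj_of_norm_le (hxB t ht W)]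
      linarith
    have i1 := (hli t ht).const_mul (1 - ζ * γ t)
    have i2 := (hxint t ht).const_mul (γ t * ((c * m₀) ^ 2 / ζ))
    have i3 := hfi.const_mul (2 * γ t)
    have i4 := (h.moment_integrable t).const_mul (γ t ^ 2 * c ^ 2)
    have hint := integral_mono (hli (t + 1) (by omega)) (((i1.add i2).add i3).add i4) hpath
    have i12 : Integrable (fun W => (1 - ζ * γ t) * ‖lam t W - lamStar‖ ^ 2 +
        γ t * ((c * m₀) ^ 2 / ζ) * ‖xi t W - xiStar‖ ^ 2) (chainLaw P w) := i1.add i2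
    have i123 : Integrable (fun W => (1 - ζ * γ t) * ‖lam t W - lamStar‖ ^ 2 +
        γ t * ((c * m₀) ^ 2 / ζ) * ‖xi t W - xiStar‖ ^ 2 +
        2 * γ t * projNoise ν G lamStar B (θ t W) (W t)) (chainLaw P w) := i12.add i3
    have hsum : ∫ W, ((1 - ζ * γ t) * ‖lam t W - lamStar‖ ^ 2 +
        γ t * ((c * m₀) ^ 2 / ζ) * ‖xi t W - xiStar‖ ^ 2 +
        2 * γ t * projNoise ν G lamStar B (θ t W) (W t) + γ t ^ 2 * c ^ 2 * V (W t) ^ 2)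
          ∂(chainLaw P w) =
        (1 - ζ * γ t) * ∫ W, ‖lam t W - lamStar‖ ^ 2 ∂(chainLaw P w) +
        γ t * ((c * m₀) ^ 2 / ζ) * ∫ W, ‖xi t W - xiStar‖ ^ 2 ∂(chainLaw P w) +
        2 * γ t * ∫ W, projNoise ν G lamStar B (θ t W) (W t) ∂(chainLaw P w) +
        γ t ^ 2 * c ^ 2 * ∫ W, V (W t) ^ 2 ∂(chainLaw P w) := by
      rw [integral_add i123 i4, integral_add i12 i3, integral_add i1 i2]
      simp only [integral_const_mul]
    have hint' := hint.trans_eq hsum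
    have h2 := mul_le_mul_of_nonneg_left (hxi t ht₁)
      (show 0 ≤ γ t * ((c * m₀) ^ 2 / ζ) by positivity)
    have h3 := mul_le_mul_of_nonneg_left hfle (show 0 ≤ 2 * γ t by positivity)
    have h4 := mul_le_mul_of_nonneg_left (h.moment_le t) (show 0 ≤ γ t ^ 2 * c ^ 2 by positivity)
    refine (hint'.trans (add_le_add (add_le_add (add_le_add le_rfl h2) h3) h4)).trans_eq ?_
    rw [hγ t ht, hC]
    ring

end PoissonSetting

end

/-! ### The two-timescale iterates

Since the noise is removed by the Poisson equation instead of a mixing-time argument, the mean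
square error is `O(t ^ (-κ))` (resp. `O(t ^ (-δ))`) without a logarithmic factor for every
geometrically ergodic chain, in particular for i.i.d. noise. -/

section

variable {S : Type*} {m n : ℕ} {B : ℝ} {α β : ℕ → ℝ}
  {G : S → EuclideanSpace ℝ (Fin m) → EuclideanSpace ℝ (Fin n) → EuclideanSpace ℝ (Fin m)}
  {H : S → EuclideanSpace ℝ (Fin n) → EuclideanSpace ℝ (Fin n)}

lemma saIterates_succ (lam₀ : EuclideanSpace ℝ (Fin m)) (xi₀ : EuclideanSpace ℝ (Fin n))
    (W : ℕ → S) (t : ℕ) : saIterates B α β G H lam₀ xi₀ W (t + 1) =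
      (ballProj B ((saIterates B α β G H lam₀ xi₀ W t).1 + α t •
          G (W t) (saIterates B α β G H lam₀ xi₀ W t).1 (saIterates B α β G H lam₀ xi₀ W t).2),
        ballProj B ((saIterates B α β G H lam₀ xi₀ W t).2 + β t •
          H (W t) (saIterates B α β G H lam₀ xi₀ W t).2)) := rfl

lemma dependsOn_saIterates (lam₀ : EuclideanSpace ℝ (Fin m)) (xi₀ : EuclideanSpace ℝ (Fin n))
    (t : ℕ) : DependsOn (fun W => saIterates B α β G H lam₀ xi₀ W t) (Set.Iic t) := by
  induction t with
  | zero => intro W W' _; rfl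
  | succ t ih =>
    intro W W' hW
    have h1 : saIterates B α β G H lam₀ xi₀ W t = saIterates B α β G H lam₀ xi₀ W' t :=
      ih fun i hi => hW i (Set.Iic_subset_Iic.2 (Nat.le_succ t) hi)
    have h2 : W t = W' t := hW t (Set.mem_Iic.2 (Nat.le_succ t))
    simp only [saIterates_succ, h1, h2]

lemma norm_saIterates_le (hB : 0 < B) (lam₀ : EuclideanSpace ℝ (Fin m))
    (xi₀ : EuclideanSpace ℝ (Fin n)) (W : ℕ → S) {t : ℕ} (ht : 1 ≤ t) :
    ‖(saIterates B α β G H lam₀ xi₀ W t).1‖ ≤ B ∧ ‖(saIterates B α β G H lam₀ xi₀ W t).2‖ ≤ B := by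
  obtain ⟨s, rfl⟩ : ∃ s, t = s + 1 := ⟨t - 1, by omega⟩
  exact ⟨norm_ballProj_le hB _, norm_ballProj_le hB _⟩

lemma measurable_saIterates [MeasurableSpace S] (hB : 0 < B)
    (hG : Measurable (fun p : S × EuclideanSpace ℝ (Fin m) × EuclideanSpace ℝ (Fin n) =>
      G p.1 p.2.1 p.2.2))
    (hH : Measurable (fun p : S × EuclideanSpace ℝ (Fin n) => H p.1 p.2))
    (lam₀ : EuclideanSpace ℝ (Fin m)) (xi₀ : EuclideanSpace ℝ (Fin n)) (t : ℕ) :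
    Measurable (fun W => saIterates B α β G H lam₀ xi₀ W t) := by
  induction t with
  | zero => exact measurable_const
  | succ t ih =>
    simp only [saIterates_succ]
    have hW : Measurable (fun W : ℕ → S => W t) := measurable_pi_apply t
    have h1 := hG.comp (hW.prodMk (ih.fst.prodMk ih.snd))
    have h2 := hH.comp (hW.prodMk ih.snd)
    exact ((continuous_ballProj hB).measurable.comp (ih.fst.add (h1.const_smul (α t)))).prodMk
      ((continuous_ballProj hB).measurable.comp (ih.snd.add (h2.const_smul (β t))))

end

lemma integrable_norm_sub_sq {Ω : Type*} [MeasurableSpace Ω] {μ : Measure Ω} [IsFiniteMeasure μ]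
    {d : ℕ} {X : Ω → EuclideanSpace ℝ (Fin d)} (hX : Measurable X) {B : ℝ} (hB : ∀ ω, ‖X ω‖ ≤ B)
    (x : EuclideanSpace ℝ (Fin d)) : Integrable (fun ω => ‖X ω - x‖ ^ 2) μ :=
  Integrable.of_bound ((hX.sub_const x).norm.pow_const 2).aestronglyMeasurable ((B + ‖x‖) ^ 2)
    (ae_of_all _ fun ω => by
      rw [Real.norm_of_nonneg (sq_nonneg _)]
      exact pow_le_pow_left₀ (norm_nonneg _) ((norm_sub_le _ _).trans (by linarith [hB ω])) 2)

theorem proposition1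
    {E : Type*} [NormedAddCommGroup E] [MeasurableSpace E] [BorelSpace E] {𝒲 : Set E}
    (P : Kernel 𝒲 𝒲) [IsMarkovKernel P] (ν : Measure 𝒲)
    {m n : ℕ}
    (G : 𝒲 → EuclideanSpace ℝ (Fin m) → EuclideanSpace ℝ (Fin n) → EuclideanSpace ℝ (Fin m))
    (H : 𝒲 → EuclideanSpace ℝ (Fin n) → EuclideanSpace ℝ (Fin n))
    (hG : Measurable (fun p : 𝒲 × EuclideanSpace ℝ (Fin m) × EuclideanSpace ℝ (Fin n) =>
      G p.1 p.2.1 p.2.2))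
    (hH : Measurable (fun p : 𝒲 × EuclideanSpace ℝ (Fin n) => H p.1 p.2))
    (lamStar : EuclideanSpace ℝ (Fin m)) (xiStar : EuclideanSpace ℝ (Fin n)) (B ζ ψ : ℝ)
    (hP : IsGeometricallyErgodicChain P ν 2)
    (hSA : SAConditions ν G H lamStar xiStar B ζ ψ)
    (κ δ : ℝ) (hκ : 0 < κ) (hκδ : κ ≤ δ) (hδ : δ ≤ 1)
    (α β : ℕ → ℝ) (hα₀ : 0 < α 0) (hβ₀ : 0 < β 0)
    (hα : ∀ t : ℕ, 1 ≤ t → α t = α 0 * (t : ℝ) ^ (-κ))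
    (hβ : ∀ t : ℕ, 1 ≤ t → β t = β 0 * (t : ℝ) ^ (-δ))
    (hκ_one : κ = 1 → 1 < ζ * α 0) (hδ_one : δ = 1 → 1 < ψ * β 0)
    (w : 𝒲) :
    ∃ k₁ k₂ : ℝ, 0 ≤ k₁ ∧ 0 < k₂ ∧ (IsIIDGivenStart P ν w → k₁ = 0) ∧
      ∀ (lam₀ : EuclideanSpace ℝ (Fin m)) (xi₀ : EuclideanSpace ℝ (Fin n)),
        ∀ᶠ t : ℕ in atTop,
          (Integrable (fun W => ‖(saIterates B α β G H lam₀ xi₀ W t).1 - lamStar‖ ^ 2)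
              (chainLaw P w) ∧
            ∫ W, ‖(saIterates B α β G H lam₀ xi₀ W t).1 - lamStar‖ ^ 2 ∂(chainLaw P w) ≤
              (t : ℝ) ^ (-κ) * (k₁ * Real.log t + k₂)) ∧
          (Integrable (fun W => ‖(saIterates B α β G H lam₀ xi₀ W t).2 - xiStar‖ ^ 2)
              (chainLaw P w) ∧
            ∫ W, ‖(saIterates B α β G H lam₀ xi₀ W t).2 - xiStar‖ ^ 2 ∂(chainLaw P w) ≤
              (t : ℝ) ^ (-δ) * (k₁ * Real.log t + k₂)) := by
  have := hP.isProbabilityMeasure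
  obtain ⟨K, T, M, hT⟩ := hP.exists_poissonSetting w
  obtain ⟨h, L, hL, hh, hGl, hHl, hGb, hHb⟩ := hSA.lipschitz_growth
  have hlamStar : ‖lamStar‖ ≤ B := (le_max_left _ _).trans hSA.lt_radius.le
  have hxiStar : ‖xiStar‖ ≤ B := (le_max_right _ _).trans hSA.lt_radius.le
  have hB : 0 < B := (norm_nonneg lamStar).trans_lt ((le_max_left _ _).trans_lt hSA.lt_radius)
  have hLV : ∀ w : 𝒲, L * (1 + ‖(w : E)‖) ≤ 2 * L * lyapunovSqrt w := fun w => by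
    have := mul_le_mul_of_nonneg_left (one_add_norm_le_lyapunovSqrt w) hL.le
    linarith
  have hhV : ∀ w, h w ≤ 2 * L * lyapunovSqrt w := fun w => (hh w).2.trans (hLV w)
  have hGLG : LipschitzGrowth G lyapunovSqrt B (2 * L) :=
    { measurable := hG
      nonneg := by positivity
      lipschitz := fun w lam lam' xi xi' h1 h2 h3 h4 => (hGl w lam lam' xi xi' h1 h2 h3 h4).trans
        (mul_le_mul_of_nonneg_right (hhV w) (by positivity))
      growth := fun w lam xi h1 h2 => (hGb w lam xi h1 h2).trans (hLV w) }
  -- `H` is viewed as a field with a dummy second argument in a zero-dimensional space, so that the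
  -- same rate theorem applies to it.
  have hHLG : LipschitzGrowth (n := 0) (fun w xi _ => H w xi) lyapunovSqrt B (2 * L) :=
    { measurable := hH.comp (measurable_fst.prodMk measurable_snd.fst)
      nonneg := by positivity
      lipschitz := fun w xi xi' η η' h1 h2 _ _ => (hHl w xi xi' h1 h2).trans
        (mul_le_mul (hhV w) (le_add_of_nonneg_right (norm_nonneg _)) (norm_nonneg _)
          ((hh w).1.le.trans (hhV w)))
      growth := fun w xi _ h1 _ => (hHb w xi h1).trans (hLV w) }
  have hmonoG : ∀ lam, inner ℝ (lam - lamStar) (∫ w, G w lam xiStar ∂ν) ≤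
      -ζ * ‖lam - lamStar‖ ^ 2 := fun lam => by
    have h1 := hSA.monotone_G lam
    rwa [(hSA.root_G lamStar).2 rfl, sub_zero] at h1
  have hmonoH : ∀ xi, inner ℝ (xi - xiStar) (∫ w, H w xi ∂ν) ≤ -ψ * ‖xi - xiStar‖ ^ 2 := fun xi => by
    have h1 := hSA.monotone_H xi
    rwa [(hSA.root_H xiStar).2 rfl, sub_zero] at h1
  obtain ⟨Kx, tx, hKx, hxrate⟩ := hT.exists_rate_bound hHLG hB hxiStar
    (xiStar := (0 : EuclideanSpace ℝ (Fin 0))) (by simpa using hB.le) hSA.psi_pos hmonoH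
    (hκ.trans_le hκδ) hδ hβ₀ hδ_one hβ 0 (C₁ := 0) (K₁ := 0) le_rfl le_rfl
  -- Since `κ ≤ δ`, `β t ≤ (β 0 / α 0) α t`, which gives the speed constant of `ξ`. The time `max tx
  -- 1` ensures both the rate of `ξ` and `t ^ (-δ) ≤ t ^ (-κ)`.
  obtain ⟨Kl, tl, hKl, hlrate⟩ := hT.exists_rate_bound hGLG hB hlamStar hxiStar hSA.zeta_pos hmonoG
    hκ (hκδ.trans hδ) hα₀ hκ_one hα (max tx 1) (C₁ := 2 * L * (β 0 / α 0)) (K₁ := Kx)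
    (by positivity) hKx
  -- One constant serves both bounds; the added `1` makes it positive even if `Kl` and `Kx` vanish.
  refine ⟨0, Kl + Kx + 1, le_rfl, by positivity, fun _ => rfl, fun lam₀ xi₀ => ?_⟩
  have hm := measurable_saIterates (α := α) (β := β) hB hG hH lam₀ xi₀
  have hd := dependsOn_saIterates (B := B) (α := α) (β := β) (G := G) (H := H) lam₀ xi₀
  have hb := fun (t : ℕ) (ht : 1 ≤ t) (W : ℕ → 𝒲) =>
    norm_saIterates_le (α := α) (β := β) (G := G) (H := H) hB lam₀ xi₀ W ht
  have hx := hxrate (fun t W => (saIterates B α β G H lam₀ xi₀ W t).2) (fun _ _ => 0)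
    (fun t => (hm t).snd) (fun _ => measurable_const)
    (fun t W W' hW => congrArg Prod.snd (hd t hW)) (fun _ _ _ _ => rfl)
    (fun t ht W => (hb t ht W).2) (fun _ _ _ => by simpa using hB.le) (fun t _ W => rfl)
    (fun _ _ _ => by simp) (fun _ _ => by simp)
  have hl := hlrate (fun t W => (saIterates B α β G H lam₀ xi₀ W t).1)
    (fun t W => (saIterates B α β G H lam₀ xi₀ W t).2) (fun t => (hm t).fst) (fun t => (hm t).snd)
    (fun t W W' hW => congrArg Prod.fst (hd t hW)) (fun t W W' hW => congrArg Prod.snd (hd t hW))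
    (fun t ht W => (hb t ht W).1) (fun t ht W => (hb t ht W).2) (fun t _ W => rfl)
    (fun t ht W => by
      have ht0 : (1 : ℝ) ≤ t := by exact_mod_cast ht
      have hβ0 : 0 ≤ β t := by rw [hβ t ht]; positivity
      have h1 : β t ≤ β 0 / α 0 * α t := by
        rw [hβ t ht, hα t ht, ← mul_assoc, div_mul_cancel₀ _ hα₀.ne']
        exact mul_le_mul_of_nonneg_left
          (Real.rpow_le_rpow_of_exponent_le ht0 (by linarith)) hβ₀.le
      have h2 : ‖(saIterates B α β G H lam₀ xi₀ W (t + 1)).2 -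
          (saIterates B α β G H lam₀ xi₀ W t).2‖ ≤ β t * (2 * L * lyapunovSqrt (W t)) := by
        rw [saIterates_succ]
        refine (norm_ballProj_sub_le hB _ (hb t ht W).2).trans ?_
        rw [add_sub_cancel_left, norm_smul, Real.norm_of_nonneg hβ0]
        exact mul_le_mul_of_nonneg_left ((hHb _ _ (hb t ht W).2).trans (hLV _)) hβ0
      have hV0 : 0 ≤ lyapunovSqrt (W t) := zero_le_one.trans (one_le_lyapunovSqrt _)
      calc _ ≤ β t * (2 * L * lyapunovSqrt (W t)) := h2
        _ ≤ (β 0 / α 0 * α t) * (2 * L * lyapunovSqrt (W t)) := by gcongr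
        _ = _ := by ring)
    (fun t ht => (hx t ((le_max_left _ _).trans ht)).trans (mul_le_mul_of_nonneg_left
      (Real.rpow_le_rpow_of_exponent_le
        (by exact_mod_cast (le_max_right tx 1).trans ht) (by linarith)) hKx))
  filter_upwards [eventually_ge_atTop 1, eventually_ge_atTop tx, eventually_ge_atTop tl]
    with t ht htx htl
  refine ⟨⟨integrable_norm_sub_sq (hm t).fst (fun W => (hb t ht W).1) _, (hl t htl).trans ?_⟩,
    integrable_norm_sub_sq (hm t).snd (fun W => (hb t ht W).2) _, (hx t htx).trans ?_⟩
  · rw [zero_mul, zero_add, mul_comm]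
    exact mul_le_mul_of_nonneg_left (by linarith) (by positivity)
  · rw [zero_mul, zero_add, mul_comm]
    exact mul_le_mul_of_nonneg_left (by linarith) (by positivity)
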